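/- For $\alpha\in\{1,2,3,\dots\}\cup\{\infty\}$, the $\alpha$-lazy matching game is played on a finite set $D$, known in advance. In each of finitely many rounds Builder presents a new vertex $u$ with its neighbourhood $N(u)\subseteq D$; Scheduler assigns to $u$ a set $m(u)\subseteq N(u)$ with $|m(u)|\le\alpha$ (no size bound if $\alpha=\infty$), and $m(x)$ is replaced by $m(x)\setminus m(u)$ for every vertex $x$ presented earlier. Let $U$ be the set of all presented vertices. The size $n$ of the game is the maximum size of a matching in the bipartite graph on $(U,D)$ in which $u$ is adjacent to the elements of $N(u)$. The size of the matching constructed by Scheduler is the number of $u\in U$ with $m(u)\neq\emptyset$ at the end. For a deterministic on-line algorithm $\mathcal A$ of Scheduler, $\mathrm{Val}_{\mathcal A}(n)$ is the minimum size of the matching it constructs over all games of size $n$, and $\mathrm{Val}_\alpha(n)=\max_{\mathcal A}\mathrm{Val}_{\mathcal A}(n)$. The competitive ratio of the $\alpha$-lazy on-line bipartite matching problem is $\liminf_{n\to\infty}\mathrm{Val}_\alpha(n)/n$, and that of $\mathcal A$ is $\liminf_{n\to\infty}\mathrm{Val}_{\mathcal A}(n)/n$. The algorithm $\alpha$-Bal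 processes a new vertex $u$ as follows. It first puts into $m(u)$ elements of $N(u)$ that belong to no $m(x)$, as many as there are but at most $\alpha$. An element $d\in N(u)$ is called available if $m(x)\ne\{d\}$ for all $x$ presented earlier. Then, while there is an earlier vertex $e$ such that $m(e)$ contains an available element and $|m(u)|+2\le|m(e)|$, it picks such an $e$ with $|m(e)|$ maximal and moves one available element from $m(e)$ to $m(u)$. The choices left open are made arbitrarily; $\mathrm{bal}(\alpha,n)$ denotes the minimum size of the matching constructed by $\alpha$-Bal over all games of size $n$ and all such choices. **Theorem.** (i) For every integer $\alpha\ge1$, $$\liminf_{n\to\infty}\frac{\mathrm{Val}_\alpha(n)}n=\liminf_{n\to\infty}\frac{\mathrm{bal}(\alpha,n)}n=1-\frac{\alpha}{1+\alpha}\prod_{i=1}^{\alpha-1}\frac{i+i^2}{1+i+i^2},$$ and every deterministic algorithm that follows the rules of $\alpha$-Bal (such algorithms exist) has this competitive ratio. (ii) As $\alpha\to\infty$, the right-hand side converges to $L=1-\pi/\cosh\frac{\sqrt3\,\pi}{2}$, and $|L-0.588|<0.0005$. (iii) The lazy matching game, in which $\alpha=\alpha(n)$ may depend on $n$ and $\alpha(n)\to\infty$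 (in particular $\alpha=\infty$, no bound on the sizes), has competitive ratio $L$ as well: for every such sequence, $\liminf_{n}\mathrm{Val}_{\alpha(n)}(n)/n=\liminf_n\mathrm{bal}(\alpha(n),n)/n=L$, and $\liminf_n \mathrm{Val}_{\mathcal A_n}(n)/n=L$ for all algorithms $\mathcal A_n$ that follow the rules of $\alpha(n)$-Bal. -/

import Mathlib

open Filter Topology

/-- The history of an on-line bipartite graph on the set of servers `D = Fin d`, known in advance:
the list of the neighbourhoods `N(u) ⊆ D` of the tasks `u` presented so far, the most recent task
first. Different positions of the list are different tasks. -/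
abbrev History (d : ℕ) : Type := List (Finset (Fin d))

/-- `M` is a matching of the bipartite graph `G = (U, D, E)` revealed by `l`, where `U` is the set
of positions of `l` and `(u, s) ∈ E` iff `s ∈ N(u)`. -/
def IsBipartiteMatching {d : ℕ} (l : History d) (M : Finset (Fin l.length × Fin d)) : Prop :=
  (∀ e ∈ M, e.2 ∈ l.get e.1) ∧
    Set.InjOn Prod.fst (M : Set (Fin l.length × Fin d)) ∧
    Set.InjOn Prod.snd (M : Set (Fin l.length × Fin d))

/-- The game in which Builder presents `l` has size `n`: the maximum size of a matching in the
underlying graph is `n`. -/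
def HasSize {d : ℕ} (l : History d) (n : ℕ) : Prop :=
  IsGreatest {c : ℕ | ∃ M : Finset (Fin l.length × Fin d),
    IsBipartiteMatching l M ∧ M.card = c} n

/-- A (deterministic, on-line) algorithm for Scheduler in the `α`-lazy matching game; `α = ⊤` means
that there is no bound on the number of servers assigned to a task. Given the number of servers,
the tasks presented earlier and the neighbourhood `N` of the new task `u`, it
chooses `m(u) ⊆ N` with `|m(u)| ≤ α`. -/
structure LazyAlgorithm (α : ℕ∞) where
  assign : (d : ℕ) → History d → Finset (Fin d) → Finset (Fin d)
  assign_subset : ∀ (d : ℕ) (past : History d) (N : Finset (Fin d)), assign d past N ⊆ N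
  card_assign_le : ∀ (d : ℕ) (past : History d) (N : Finset (Fin d)),
    ((assign d past N).card : ℕ∞) ≤ α

namespace LazyAlgorithm

variable {α : ℕ∞}

/-- The list of the current sets `m(u)`, one for each presented task `u` (in the order of the
history). When a new task gets the set `S`, every earlier `m(x)` is replaced by `m(x) \ S`. -/
def run (A : LazyAlgorithm α) {d : ℕ} : History d → List (Finset (Fin d))
  | [] => []
  | N :: past => A.assign d past N :: (run A past).map (fun M => M \ A.assign d past N)

/-- The size of the matching constructed by the algorithm: the number of tasks `u` with
`m(u) ≠ ∅` at the end. -/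
def matched (A : LazyAlgorithm α) {d : ℕ} (l : History d) : ℕ :=
  (A.run l).countP (fun M => M ≠ ∅)

/-- `Val_A(n)`: the worst-case size of the matching constructed by `A` in all games of size `n`. -/
noncomputable def worstCase (A : LazyAlgorithm α) (n : ℕ) : ℕ :=
  sInf {v : ℕ | ∃ (d : ℕ) (l : History d), HasSize l n ∧ A.matched l = v}

end LazyAlgorithm

/-- `Val_α(n)`: the maximum of `Val_A(n)` over all algorithms `A` for the `α`-lazy game. -/
noncomputable def lazyValue (α : ℕ∞) (n : ℕ) : ℕ :=
  sSup {v : ℕ | ∃ A : LazyAlgorithm α, A.worstCase n = v}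

/-- A server `s` is available for a new task with neighbourhood `N`, where `ms` lists the current
sets `m(x)` of the tasks `x` presented earlier. -/
def Available {d : ℕ} (ms : List (Finset (Fin d))) (N : Finset (Fin d)) (s : Fin d) : Prop :=
  s ∈ N ∧ ∀ M ∈ ms, M ≠ {s}

/-- The set of strongly available servers: those that are available and belong to no current
`m(x)` (the latter implies `m(x) ≠ {s}`). -/
def stronglyAvailable {d : ℕ} (ms : List (Finset (Fin d))) (N : Finset (Fin d)) :
    Finset (Fin d) :=
  N.filter (fun s => ∀ M ∈ ms, s ∉ M)

/-- `M = m(e)` is the current set of an earlier task `e` which is ready for the new task `u` and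
satisfies `|m(u)| + 2 ≤ |m(e)|`, where `S` is the current set `m(u)`. -/
def IsDonor {d : ℕ} (ms : List (Finset (Fin d))) (N S M : Finset (Fin d)) : Prop :=
  M ∈ ms ∧ (∃ s ∈ M, Available ms N s) ∧ S.card + 2 ≤ M.card

/-- `BalReach α ms N S`: while processing a new task `u` with neighbourhood `N`, when the sets of
the earlier tasks at the beginning of the round are `ms`, the algorithm `α`-Bal can arrive at
`m(u) = S`. At that moment the sets of the earlier tasks are the sets `M \ S`, `M ∈ ms`. -/
inductive BalReach (α : ℕ∞) {d : ℕ} (ms : List (Finset (Fin d))) (N : Finset (Fin d)) :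
    Finset (Fin d) → Prop
  /-- Pick strongly available servers, as many as there are, but at most `α`. -/
  | start (S : Finset (Fin d)) (hS : S ⊆ stronglyAvailable ms N)
      (hcard : (S.card : ℕ∞) = min α ((stronglyAvailable ms N).card : ℕ∞)) :
      BalReach α ms N S
  /-- Move one available server `s` to `m(u)` from a set `M = m(e)` of maximal size among the
  tasks that satisfy the condition of the loop. -/
  | move (S M : Finset (Fin d)) (s : Fin d) (hS : BalReach α ms N S)
      (hM : IsDonor (ms.map (fun M' => M' \ S)) N S M)
      (hmax : ∀ M', IsDonor (ms.map (fun M'' => M'' \ S)) N S M' → M'.card ≤ M.card)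
      (hs : s ∈ M) (hav : Available (ms.map (fun M' => M' \ S)) N s) :
      BalReach α ms N (insert s S)

/-- `α`-Bal can finish the processing of the new task with `m(u) = S`: it can arrive at `S`, and the
condition of the loop fails there. -/
def BalOutput (α : ℕ∞) {d : ℕ} (ms : List (Finset (Fin d))) (N S : Finset (Fin d)) : Prop :=
  BalReach α ms N S ∧ ∀ M, ¬ IsDonor (ms.map (fun M' => M' \ S)) N S M

/-- The algorithm `A` is `α`-Bal, with some way of making the choices that `α`-Bal leaves open. -/
def LazyAlgorithm.IsBal {α : ℕ∞} (A : LazyAlgorithm α) : Prop :=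
  ∀ (d : ℕ) (past : History d) (N : Finset (Fin d)),
    BalOutput α (A.run past) N (A.assign d past N)

/-- `bal(α, n)`: the worst size of the matching constructed by `α`-Bal in games of size `n`, also
over all ways of making the choices that `α`-Bal leaves open. -/
noncomputable def balValue (α : ℕ∞) (n : ℕ) : ℕ :=
  sInf {v : ℕ | ∃ A : LazyAlgorithm α, A.IsBal ∧ A.worstCase n = v}

/-- The competitive ratio `liminf v(n) / n`; all the functions `v` of interest have values
in `[0, n]`. -/
noncomputable def competitiveRatio (v : ℕ → ℕ) : ℝ :=
  liminf (fun n : ℕ => (v n : ℝ) / (n : ℝ)) atTop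

/-- `1 - α / (1 + α) * ∏_{i = 1}^{α - 1} (i + i²) / (1 + i + i²)`. -/
noncomputable def lazyRatio (α : ℕ) : ℝ :=
  1 - (α : ℝ) / (1 + (α : ℝ)) *
    ∏ i ∈ Finset.Icc 1 (α - 1), ((i : ℝ) + (i : ℝ) ^ 2) / (1 + (i : ℝ) + (i : ℝ) ^ 2)

/-- `1 - π / cosh (√3 π / 2)`. -/
noncomputable def lazyRatioLimit : ℝ :=
  1 - Real.pi / Real.cosh (Real.sqrt 3 * Real.pi / 2)

/-!
The game is analysed with one sequence of weights. Put `share 1 = 1` and `share (i + 1) = share i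
* (i + i²) / (1 + i + i²)`. This recursion says exactly that a new task which takes one server
from each of `i` tasks holding `i + 1` servers raises the sum of the weights of all assigned
servers by the weight of a single server (`share_mul_sub_slope`), when a server in a set of size
`i` weighs `share i`. The weight `1` of a server that is the only one of its task stands for one
unmatched task, which Builder obtains by a task adjacent to this server alone. For finite `α` an
unassigned server weighs `ρ = α * share α / (1 + α)`, for `α = ∞` it weighs the limit of `share`;
the claimed ratio is `1 - ρ`.

*Balancing guarantees `(1 - ρ) * n`.* Fix a maximum matching, and let a server of this matching
count as long as its partner has not been presented. When a task becomes matched, the total weight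
rises by at most some `τ ≤ 1`, and each server adjacent to that task weighs at least `τ`
afterwards (`BalOutput.exists_weight_bound`): by the balancing rule, sets which gave up servers
remain at least as large as the new one, and adjacent servers that could not be taken lie in sets
which exceed it by at most one. So if the task has a partner, the departure of this server pays
for the rise, and otherwise the new matched task does. When a task stays unmatched, its partner
departs with weight `1`. Comparing the start and the end of the game gives the bound
(`LazyAlgorithm.IsBal.le_matched`).

*Builder holds every algorithm to `(1 - ρ) * n + o(n)`.* Every new task is adjacent to all the
servers in play, so that it can later be matched to any server which is given up. A task that
holds `l` servers is valued at `l * share l`, and at `1` if `l = 0`. This is a convex function of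
`l`, with increments `valueSlope l`. While Builder attacks the sets with more than `i` elements,
the increments are frozen from `i` on; then every answer of Scheduler raises the total value by at
least `share (i + 1)`, and giving up a set of size `l > i` costs at most `share (i + 1) * l` and
provides partners for `l` tasks. Hence nothing is lost but a constant for each `i`
(`Position.split`, `Position.exploit`). In the end all sets in play have at most one element, and
up to a constant their number is the number of tasks that stay unmatched (`Position.finish`).
While there are untouched servers, a new task is matched to one of these (`Position.opening`).
Their value may be taken as `ρ` for finite `α`, and as `valueSlope i`, for any `i`, for arbitrary
`α`; the latter is close to the limit of `share` for large `i`, uniformly in `α`.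

The limit of `share` is computed from `1 + j + j² = (s + j) * (1 - s + j)`, for `s = 1 / 2 + i *
√3 / 2`, by Euler's limit formula and the reflection formula for the Gamma function.
-/

/-! ### Server weights and task values -/

/-- The weight of a server that belongs to a set `m(e)` of size `i ≥ 1`: the number of unmatched
tasks, per server, that optimal play extracts from tasks holding `i` servers each. The value at `0`
is `1`, so that `share` is antitone. -/
noncomputable def share (i : ℕ) : ℝ :=
  ∏ j ∈ Finset.Icc 1 (i - 1), ((j : ℝ) + (j : ℝ) ^ 2) / (1 + (j : ℝ) + (j : ℝ) ^ 2)

/-- The increase of the value of a task when its set grows from `i` to `i + 1` servers. -/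
noncomputable def valueSlope (i : ℕ) : ℝ := share (i + 1) * i / (i + 1)

/-- The value of a task that holds `l` servers, with the increments frozen from `i` on. For
`1 ≤ l ≤ i + 1` it is `l * share l`; a task without servers has value `1`, since it is unmatched. -/
noncomputable def taskValue (i l : ℕ) : ℝ := 1 + ∑ t ∈ Finset.range l, valueSlope (min t i)

theorem lazyRatio_eq (α : ℕ) : lazyRatio α = 1 - (α : ℝ) * share α / (1 + (α : ℝ)) := by
  rw [lazyRatio, share]; ring

@[simp] theorem share_zero : share 0 = 1 := by simp [share]

@[simp] theorem share_one : share 1 = 1 := by simp [share]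

theorem share_succ {i : ℕ} (hi : 1 ≤ i) :
    share (i + 1) = share i * (((i : ℝ) + (i : ℝ) ^ 2) / (1 + (i : ℝ) + (i : ℝ) ^ 2)) := by
  obtain ⟨k, rfl⟩ := Nat.exists_eq_add_of_le' hi
  simp only [share, Nat.add_sub_cancel]
  rw [Finset.prod_Icc_succ_top (by omega)]

theorem share_pos (i : ℕ) : 0 < share i := by
  refine Finset.prod_pos fun j hj => ?_
  have : (1 : ℝ) ≤ j := by exact_mod_cast (Finset.mem_Icc.1 hj).1
  positivity

theorem share_succ_le (i : ℕ) : share (i + 1) ≤ share i := by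
  rcases Nat.eq_zero_or_pos i with rfl | hi
  · simp
  · rw [share_succ hi]
    refine mul_le_of_le_one_right (share_pos i).le ?_
    rw [div_le_one (by positivity)]
    linarith

theorem share_antitone : Antitone share := antitone_nat_of_succ_le share_succ_le

theorem share_le_one (i : ℕ) : share i ≤ 1 := by
  simpa using share_antitone (Nat.zero_le i)

@[simp] theorem valueSlope_zero : valueSlope 0 = 0 := by simp [valueSlope]

theorem valueSlope_mul (i : ℕ) : valueSlope i * (i + 1) = share (i + 1) * i := by
  rw [valueSlope]; field_simp

theorem valueSlope_mono : Monotone valueSlope := by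
  refine monotone_nat_of_le_succ fun i => ?_
  have h := share_succ (i := i + 1) (by omega)
  have hp := share_pos (i + 1)
  rw [valueSlope, valueSlope, h, mul_div_assoc, mul_assoc, mul_div_assoc]
  refine mul_le_mul_of_nonneg_left ?_ hp.le
  push_cast
  rw [div_mul_eq_mul_div, div_div, div_le_div_iff₀ (by positivity) (by positivity)]
  have : (0 : ℝ) ≤ i := i.cast_nonneg
  nlinarith [pow_nonneg this 2, pow_nonneg this 3]

theorem valueSlope_le_share_succ (i : ℕ) : valueSlope i ≤ share (i + 1) := by
  have h := valueSlope_mul i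
  have hp := share_pos (i + 1)
  have : (0 : ℝ) ≤ i := i.cast_nonneg
  nlinarith

theorem valueSlope_nonneg (i : ℕ) : 0 ≤ valueSlope i := by
  have := share_pos (i + 1)
  rw [valueSlope]; positivity

/-- The identity that defines the weights: a new task which takes one server from each of `i` tasks
with `i + 1` servers raises the total weight by the weight of a single server. -/
theorem share_mul_sub_slope {i : ℕ} (hi : 1 ≤ i) :
    (i : ℝ) * share i - i * valueSlope i = share (i + 1) := by
  have h1 : (0 : ℝ) < i := by exact_mod_cast hi
  rw [valueSlope, share_succ hi]
  field_simp
  ring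

theorem share_mul_succ_sub (i : ℕ) (hi : 1 ≤ i) :
    ((i + 1 : ℕ) : ℝ) * share (i + 1) - i * share i = valueSlope i := by
  have := share_mul_sub_slope hi
  have := valueSlope_mul i
  push_cast
  linarith

theorem taskValue_succ (i l : ℕ) : taskValue i (l + 1) = taskValue i l + valueSlope (min l i) := by
  rw [taskValue, taskValue, Finset.sum_range_succ]; ring

@[simp] theorem taskValue_zero (i : ℕ) : taskValue i 0 = 1 := by simp [taskValue]

theorem taskValue_add_le (i l t : ℕ) : taskValue i (l + t) ≤ taskValue i l + t * valueSlope i := by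
  induction t with
  | zero => simp
  | succ t ih =>
    rw [← add_assoc, taskValue_succ]
    have := valueSlope_mono (min_le_right (l + t) i)
    push_cast
    linarith

theorem taskValue_self (i : ℕ) : taskValue i i = share (i + 1) + i * valueSlope i := by
  have key : ∀ l, l ≤ i → taskValue i l = share (l + 1) + l * valueSlope l := by
    intro l
    induction l with
    | zero => simp
    | succ l ih =>
      intro hl
      rw [taskValue_succ, ih (by omega), min_eq_left (by omega)]
      have := share_mul_sub_slope (i := l + 1) (by omega)
      have := valueSlope_mul l
      push_cast at *
      linarith
  exact key i le_rfl

theorem taskValue_of_le {i l : ℕ} (h : i ≤ l) :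
    taskValue i l = share (i + 1) + l * valueSlope i := by
  obtain ⟨t, rfl⟩ := Nat.exists_eq_add_of_le h
  induction t with
  | zero => simpa using taskValue_self i
  | succ t ih =>
    rw [← add_assoc, taskValue_succ, ih (by omega), min_eq_right (by omega)]
    push_cast
    ring

theorem le_taskValue (i l : ℕ) : share (i + 1) + l * valueSlope i ≤ taskValue i l := by
  rcases le_total i l with h | h
  · exact (taskValue_of_le h).ge
  · obtain ⟨t, rfl⟩ := Nat.exists_eq_add_of_le h
    have h1 := taskValue_add_le (l + t) l t
    have h2 := taskValue_self (l + t)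
    push_cast at *
    linarith

theorem taskValue_le_of_lt {i l : ℕ} (h : i < l) : taskValue i l ≤ share (i + 1) * l := by
  rw [taskValue_of_le h.le]
  have h1 := valueSlope_mul i
  have h2 := valueSlope_le_share_succ i
  have h3 : (i : ℝ) + 1 ≤ l := by exact_mod_cast h
  nlinarith

theorem taskValue_succ_left {i l : ℕ} (h : l ≤ i + 1) : taskValue (i + 1) l = taskValue i l := by
  rw [taskValue, taskValue]
  congr 1
  refine Finset.sum_congr rfl fun t ht => ?_
  have := Finset.mem_range.1 ht
  congr 1
  omega

theorem mul_slope_le_sub {j l : ℕ} (hj : 1 ≤ j) (t : ℕ) (h : j ≤ l) :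
    t * valueSlope j ≤ ((l + t : ℕ) : ℝ) * share (l + t) - l * share l := by
  induction t with
  | zero => simp
  | succ t ih =>
    have h1 := share_mul_succ_sub (l + t) (by omega)
    have h2 : valueSlope j ≤ valueSlope (l + t) := valueSlope_mono (by omega)
    rw [← add_assoc]
    push_cast at *
    linarith

/-! ### The limit of the weights -/

/-- The limit is evaluated by Euler's limit formula and the reflection formula for `Γ`, from the
factorization `1 + j + j² = (s + j) * (1 - s + j)` with `s = 1 / 2 + i * √3 / 2`. -/
theorem tendsto_share :
    Tendsto share atTop (𝓝 (Real.pi / Real.cosh (Real.sqrt 3 * Real.pi / 2))) := by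
  set s : ℂ := 1 / 2 + (Real.sqrt 3 / 2 : ℝ) * Complex.I with hs
  have hsq : ((Real.sqrt 3 : ℝ) : ℂ) ^ 2 = 3 := by
    exact_mod_cast Real.sq_sqrt (show (0 : ℝ) ≤ 3 by norm_num)
  have hfac : ∀ j : ℕ, (s + j) * (1 - s + j) = 1 + (j : ℂ) + (j : ℂ) ^ 2 := by
    intro j
    rw [hs]
    push_cast
    linear_combination (-(Complex.I ^ 2 : ℂ) / 4) * hsq - (3 / 4 : ℂ) * Complex.I_sq
  have hsin : Complex.sin (Real.pi * s) = (Real.cosh (Real.sqrt 3 * Real.pi / 2) : ℝ) := by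
    have : (Real.pi : ℂ) * s
        = ((Real.sqrt 3 * Real.pi / 2 : ℝ) : ℂ) * Complex.I + Real.pi / 2 := by
      rw [hs]; push_cast; ring
    rw [this, Complex.sin_add_pi_div_two, Complex.cos_mul_I]
    push_cast
    rfl
  have hlim := (Complex.GammaSeq_tendsto_Gamma s).mul (Complex.GammaSeq_tendsto_Gamma (1 - s))
  rw [Complex.Gamma_mul_Gamma_one_sub, hsin] at hlim
  have hseq : ∀ n : ℕ, 1 ≤ n → (share (n + 1) : ℂ)
      = (1 + ((1 / (n : ℝ) : ℝ) : ℂ)) * (Complex.GammaSeq s n * Complex.GammaSeq (1 - s) n) := by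
    intro n hn
    have hn0 : (n : ℂ) ≠ 0 := by exact_mod_cast (by omega : n ≠ 0)
    have hpow : (n : ℂ) ^ s * (n : ℂ) ^ (1 - s) = n := by
      rw [← Complex.cpow_add _ _ hn0]; simp
    have hden : (∏ j ∈ Finset.range (n + 1), (s + j)) * ∏ j ∈ Finset.range (n + 1), (1 - s + j)
        = ∏ j ∈ Finset.range (n + 1), (1 + (j : ℂ) + (j : ℂ) ^ 2) := by
      rw [← Finset.prod_mul_distrib]
      exact Finset.prod_congr rfl fun j _ => hfac j
    have hclosed : ∀ n : ℕ, (share (n + 1) : ℂ)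
        * ∏ j ∈ Finset.range (n + 1), (1 + (j : ℂ) + (j : ℂ) ^ 2)
          = (n + 1) * (n.factorial : ℂ) * (n.factorial : ℂ) := by
      intro n
      induction n with
      | zero => simp
      | succ n ih =>
        have hne : (1 + ((n + 1 : ℕ) : ℂ) + ((n + 1 : ℕ) : ℂ) ^ 2) ≠ 0 := by
          norm_cast
          omega
        rw [Finset.prod_range_succ, share_succ (by omega), Nat.factorial_succ]
        push_cast at *
        field_simp
        linear_combination ((n : ℂ) + 2) * ih
    have hden0 : ∏ j ∈ Finset.range (n + 1), (1 + (j : ℂ) + (j : ℂ) ^ 2) ≠ 0 := by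
      refine Finset.prod_ne_zero_iff.2 fun j _ => ?_
      norm_cast
      omega
    rw [Complex.GammaSeq, Complex.GammaSeq, div_mul_div_comm, hden, ← mul_div_assoc,
      eq_div_iff hden0, hclosed n]
    push_cast
    field_simp
    linear_combination (-(n.factorial : ℂ) ^ 2) * hpow
  have hone : Tendsto (fun n : ℕ => (1 + ((1 / (n : ℝ) : ℝ) : ℂ))) atTop (𝓝 1) := by
    have := (Complex.continuous_ofReal.tendsto _).comp tendsto_one_div_atTop_nhds_zero_nat
    simpa using tendsto_const_nhds.add this
  have h := hone.mul hlim
  rw [one_mul] at h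
  rw [← tendsto_add_atTop_iff_nat 1]
  have h' : Tendsto (fun n : ℕ => (share (n + 1) : ℂ)) atTop
      (𝓝 ((Real.pi / Real.cosh (Real.sqrt 3 * Real.pi / 2) : ℝ) : ℂ)) := by
    push_cast at h ⊢
    refine h.congr' ?_
    filter_upwards [eventually_ge_atTop 1] with n hn
    rw [hseq n hn]
    push_cast
    rfl
  exact (Complex.continuous_re.tendsto _).comp h'

theorem tendsto_natCast_div_one_add :
    Tendsto (fun n : ℕ => (n : ℝ) / (1 + (n : ℝ))) atTop (𝓝 1) := by
  simpa [add_comm] using tendsto_natCast_div_add_atTop (1 : ℝ)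

theorem tendsto_lazyRatio : Tendsto lazyRatio atTop (𝓝 lazyRatioLimit) := by
  have h := (tendsto_natCast_div_one_add.mul tendsto_share).const_sub 1
  rw [one_mul] at h
  refine h.congr fun n => ?_
  rw [lazyRatio_eq]; ring

theorem tendsto_one_sub_slope : Tendsto (fun i => 1 - valueSlope i) atTop (𝓝 lazyRatioLimit) := by
  have h := (tendsto_natCast_div_one_add.mul
    (tendsto_share.comp (tendsto_add_atTop_nat 1))).const_sub 1
  rw [one_mul] at h
  refine h.congr fun n => ?_
  simp only [Function.comp, valueSlope]; ring

theorem abs_lazyRatioLimit_sub_lt : |lazyRatioLimit - 0.588| < 0.0005 := by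
  have hpi1 := Real.pi_gt_d6
  have hpi2 := Real.pi_lt_d6
  have hs1 : (1.73205 : ℝ) < Real.sqrt 3 := Real.lt_sqrt_of_sq_lt (by norm_num)
  have hs2 : Real.sqrt 3 < (1.73206 : ℝ) := by
    rw [Real.sqrt_lt' (by norm_num)]; norm_num
  set x := Real.sqrt 3 * Real.pi / 2 with hx
  have hx1 : 2.7206 < x := by rw [hx]; nlinarith
  have hx2 : x < 2.7208 := by rw [hx]; nlinarith
  have he1 := Real.exp_one_gt_d9
  have he2 := Real.exp_one_lt_d9
  have b1 := abs_le.1 (Real.exp_bound (x := 0.7206) (by norm_num [abs_le]) (n := 8) (by norm_num))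
  have b2 := abs_le.1 (Real.exp_bound (x := 0.7208) (by norm_num [abs_le]) (n := 8) (by norm_num))
  norm_num [Finset.sum_range_succ, Nat.factorial] at b1 b2
  -- The Taylor bounds need an argument in `[-1, 1]`, hence the factor `exp 1 ^ 2`.
  have hsplit : ∀ y : ℝ, Real.exp (2 + y) = Real.exp 1 * Real.exp 1 * Real.exp y := by
    intro y
    rw [← Real.exp_add, ← Real.exp_add]; norm_num
  have hE1 : 15.18 < Real.exp x := by
    refine lt_of_lt_of_le ?_ (Real.exp_le_exp.2 hx1.le)
    rw [show (2.7206 : ℝ) = 2 + 0.7206 by norm_num, hsplit]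
    have h1 : (7.389 : ℝ) < Real.exp 1 * Real.exp 1 := by nlinarith
    have h2 : (2.0556 : ℝ) < Real.exp 0.7206 := by norm_num; linarith [b1.1]
    nlinarith
  have hE2 : Real.exp x < 15.2 := by
    refine lt_of_le_of_lt (Real.exp_le_exp.2 hx2.le) ?_
    rw [show (2.7208 : ℝ) = 2 + 0.7208 by norm_num, hsplit]
    have h1 : Real.exp 1 * Real.exp 1 < (7.3891 : ℝ) := by nlinarith
    have h2 : Real.exp 0.7208 < (2.0562 : ℝ) := by norm_num; linarith [b2.2]
    have h3 := Real.exp_pos (0.7208 : ℝ)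
    nlinarith
  have hE3 : Real.exp (-x) * Real.exp x = 1 := by rw [← Real.exp_add]; simp
  have hcosh : Real.cosh x = (Real.exp x + Real.exp (-x)) / 2 := Real.cosh_eq x
  have hn1 : 0.0657 < Real.exp (-x) := by nlinarith
  have hn2 : Real.exp (-x) < 0.066 := by nlinarith
  have hc : 0 < Real.cosh x := Real.cosh_pos x
  have d1 : Real.pi / Real.cosh x < 0.4125 := by rw [div_lt_iff₀ hc]; linarith
  have d2 : 0.4115 < Real.pi / Real.cosh x := by rw [lt_div_iff₀ hc]; linarith
  rw [lazyRatioLimit, abs_lt]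
  constructor <;> linarith

/-! ### Lists of pairwise disjoint sets -/

section Lists

variable {β : Type*} [DecidableEq β]

/-- The union of the members of a list of sets. -/
def listUnion (L : List (Finset β)) : Finset β := L.foldr (· ∪ ·) ∅

@[simp] theorem listUnion_nil : listUnion ([] : List (Finset β)) = ∅ := rfl

@[simp] theorem listUnion_cons (M : Finset β) (L : List (Finset β)) :
    listUnion (M :: L) = M ∪ listUnion L := rfl

theorem mem_listUnion {L : List (Finset β)} {s : β} : s ∈ listUnion L ↔ ∃ M ∈ L, s ∈ M := by
  induction L with
  | nil => simp
  | cons M L ih => simp [ih]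

theorem disjoint_listUnion {L : List (Finset β)} {S : Finset β} (h : ∀ M ∈ L, Disjoint S M) :
    Disjoint S (listUnion L) := by
  rw [Finset.disjoint_left]
  intro s hs hs'
  obtain ⟨M, hM, hsM⟩ := mem_listUnion.1 hs'
  exact Finset.disjoint_left.1 (h M hM) hs hsM

theorem sum_listUnion {L : List (Finset β)} (hL : L.Pairwise Disjoint) (f : β → ℝ) :
    ∑ s ∈ listUnion L, f s = (L.map fun M => ∑ s ∈ M, f s).sum := by
  induction L with
  | nil => simp
  | cons M L ih =>
    rw [List.pairwise_cons] at hL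
    rw [listUnion_cons, Finset.sum_union (disjoint_listUnion hL.1), ih hL.2, List.map_cons,
      List.sum_cons]

theorem card_listUnion {L : List (Finset β)} (hL : L.Pairwise Disjoint) :
    (listUnion L).card = (L.map Finset.card).sum := by
  induction L with
  | nil => simp
  | cons M L ih =>
    rw [List.pairwise_cons] at hL
    rw [listUnion_cons, Finset.card_union_of_disjoint (disjoint_listUnion hL.1), ih hL.2,
      List.map_cons, List.sum_cons]

theorem listUnion_map_sdiff (L : List (Finset β)) (S : Finset β) :
    listUnion (L.map fun M => M \ S) = listUnion L \ S := by
  induction L with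
  | nil => simp
  | cons M L ih => simp [ih, Finset.union_sdiff_distrib]

theorem listUnion_map_inter (L : List (Finset β)) (S : Finset β) :
    listUnion (L.map fun M => M ∩ S) = listUnion L ∩ S := by
  induction L with
  | nil => simp
  | cons M L ih => simp [ih, Finset.union_inter_distrib_right]

theorem pairwise_disjoint_map_sdiff {L : List (Finset β)} (hL : L.Pairwise Disjoint)
    (S : Finset β) : (L.map fun M => M \ S).Pairwise Disjoint :=
  hL.map _ fun _ _ h => h.mono Finset.sdiff_subset Finset.sdiff_subset

theorem pairwise_disjoint_cons_map_sdiff {L : List (Finset β)} (hL : L.Pairwise Disjoint)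
    (S : Finset β) : (S :: L.map fun M => M \ S).Pairwise Disjoint := by
  refine List.pairwise_cons.2 ⟨?_, pairwise_disjoint_map_sdiff hL S⟩
  intro M hM
  obtain ⟨M', -, rfl⟩ := List.mem_map.1 hM
  exact Finset.disjoint_sdiff

theorem pairwise_disjoint_map_inter {L : List (Finset β)} (hL : L.Pairwise Disjoint)
    (S : Finset β) : (L.map fun M => M ∩ S).Pairwise Disjoint :=
  hL.map _ fun _ _ h => h.mono Finset.inter_subset_left Finset.inter_subset_left

end Lists

theorem eq_or_disjoint_of_mem {β : Type*} {L : List (Finset β)} (hL : L.Pairwise Disjoint)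
    {M M' : Finset β} (hM : M ∈ L) (hM' : M' ∈ L) : M = M' ∨ Disjoint M M' := by
  have : Std.Symm (Disjoint : Finset β → Finset β → Prop) := ⟨fun _ _ h => h.symm⟩
  exact or_iff_not_imp_left.2 fun h => hL.forall hM hM' h

/-! ### Matchings along a history -/

/-- `Matches l Z`: the graph revealed by `l` has a matching whose set of servers is `Z`. -/
inductive Matches {d : ℕ} : History d → Finset (Fin d) → Prop
  | nil : Matches [] ∅
  | skip {l : History d} {Z : Finset (Fin d)} (N : Finset (Fin d)) :
      Matches l Z → Matches (N :: l) Z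
  | use {l : History d} {Z : Finset (Fin d)} {N : Finset (Fin d)} {s : Fin d} :
      Matches l Z → s ∈ N → s ∉ Z → Matches (N :: l) (insert s Z)

/-- The edge `e` of the graph revealed by `l`, as an edge of the graph revealed by `N :: l`. -/
def shiftEdge {d : ℕ} (N : Finset (Fin d)) (l : History d) :
    Fin l.length × Fin d ↪ Fin (N :: l).length × Fin d where
  toFun e := (e.1.succ, e.2)
  inj' a b hab := by
    simp only [Prod.mk.injEq, Fin.succ_inj] at hab
    exact Prod.ext hab.1 hab.2

/-- The edge between the most recent task and the server `s`. -/
def newEdge {d : ℕ} (N : Finset (Fin d)) (l : History d) (s : Fin d) :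
    Fin (N :: l).length × Fin d :=
  (⟨0, by simp⟩, s)

theorem eq_newEdge_or_shiftEdge {d : ℕ} {N : Finset (Fin d)} {l : History d}
    (e : Fin (N :: l).length × Fin d) : (∃ s, e = newEdge N l s) ∨ ∃ e', e = shiftEdge N l e' := by
  obtain ⟨i, s⟩ := e
  exact Fin.cases (motive := fun i => (∃ t, (i, s) = newEdge N l t) ∨
    ∃ e', (i, s) = shiftEdge N l e') (Or.inl ⟨s, rfl⟩) (fun i => Or.inr ⟨(i, s), rfl⟩) i

theorem shiftEdge_fst_ne {d : ℕ} {N : Finset (Fin d)} {l : History d}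
    (e : Fin l.length × Fin d) (s : Fin d) : (shiftEdge N l e).1 ≠ (newEdge N l s).1 :=
  Fin.succ_ne_zero _

theorem isBipartiteMatching_map_shiftEdge {d : ℕ} {N : Finset (Fin d)} {l : History d}
    {M : Finset (Fin l.length × Fin d)} :
    IsBipartiteMatching (N :: l) (M.map (shiftEdge N l)) ↔ IsBipartiteMatching l M := by
  constructor
  · rintro ⟨h1, h2, h3⟩
    have hmem : ∀ {e}, e ∈ M → shiftEdge N l e ∈ M.map (shiftEdge N l) :=
      fun h => Finset.mem_map_of_mem _ h
    exact ⟨fun e he => h1 _ (hmem he),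
      fun a ha b hb hab => (shiftEdge N l).injective
        (h2 (hmem ha) (hmem hb) (congrArg Fin.succ hab)),
      fun a ha b hb hab => (shiftEdge N l).injective (h3 (hmem ha) (hmem hb) hab)⟩
  · rintro ⟨h1, h2, h3⟩
    refine ⟨fun e he => ?_, fun a ha b hb hab => ?_, fun a ha b hb hab => ?_⟩
    · obtain ⟨e', he', rfl⟩ := Finset.mem_map.1 he
      exact h1 e' he'
    · obtain ⟨a', ha', rfl⟩ := Finset.mem_map.1 (Finset.mem_coe.1 ha)
      obtain ⟨b', hb', rfl⟩ := Finset.mem_map.1 (Finset.mem_coe.1 hb)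
      exact congrArg _ (h2 ha' hb' (Fin.succ_inj.1 hab))
    · obtain ⟨a', ha', rfl⟩ := Finset.mem_map.1 (Finset.mem_coe.1 ha)
      obtain ⟨b', hb', rfl⟩ := Finset.mem_map.1 (Finset.mem_coe.1 hb)
      exact congrArg _ (h3 ha' hb' hab)

theorem image_snd_map_shiftEdge {d : ℕ} (N : Finset (Fin d)) (l : History d)
    (M : Finset (Fin l.length × Fin d)) :
    (M.map (shiftEdge N l)).image Prod.snd = M.image Prod.snd := by
  rw [Finset.map_eq_image, Finset.image_image]
  rfl

theorem Matches.exists_isBipartiteMatching {d : ℕ} {l : History d} {Z : Finset (Fin d)}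
    (h : Matches l Z) : ∃ M, IsBipartiteMatching l M ∧ M.image Prod.snd = Z := by
  induction h with
  | nil => exact ⟨∅, by simp [IsBipartiteMatching], rfl⟩
  | @skip l Z N _ ih =>
    obtain ⟨M, hM, rfl⟩ := ih
    exact ⟨M.map (shiftEdge N l), isBipartiteMatching_map_shiftEdge.2 hM,
      image_snd_map_shiftEdge N l M⟩
  | @use l Z N s _ hsN hsZ ih =>
    obtain ⟨M, hM, rfl⟩ := ih
    obtain ⟨h1, h2, h3⟩ := isBipartiteMatching_map_shiftEdge (N := N).2 hM
    rw [← image_snd_map_shiftEdge N] at hsZ ⊢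
    have hfst : ∀ e ∈ M.map (shiftEdge N l), e.1 ≠ (newEdge N l s).1 := by
      intro e he
      obtain ⟨e, -, rfl⟩ := Finset.mem_map.1 he
      exact shiftEdge_fst_ne e s
    have hsnd : ∀ e ∈ M.map (shiftEdge N l), e.2 ≠ s := fun e he hes =>
      hsZ (Finset.mem_image.2 ⟨e, he, hes⟩)
    have hnot : newEdge N l s ∉ (M.map (shiftEdge N l) : Set (Fin (N :: l).length × Fin d)) :=
      fun h => hsnd _ (Finset.mem_coe.1 h) rfl
    refine ⟨insert (newEdge N l s) (M.map (shiftEdge N l)), ⟨?_, ?_, ?_⟩, Finset.image_insert ..⟩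
    · intro e he
      rcases Finset.mem_insert.1 he with rfl | he
      exacts [hsN, h1 e he]
    · rw [Finset.coe_insert, Set.injOn_insert hnot]
      exact ⟨h2, fun ⟨e, he, hes⟩ => hfst e he hes⟩
    · rw [Finset.coe_insert, Set.injOn_insert hnot]
      exact ⟨h3, fun ⟨e, he, hes⟩ => hsnd e he hes⟩

theorem IsBipartiteMatching.matches {d : ℕ} {l : History d} {M : Finset (Fin l.length × Fin d)}
    (h : IsBipartiteMatching l M) : Matches l (M.image Prod.snd) := by
  induction l with
  | nil =>
    have : M = ∅ := Finset.eq_empty_of_forall_notMem fun e _ => e.1.elim0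
    subst this
    exact Matches.nil
  | cons N l ih =>
    obtain ⟨h1, h2, h3⟩ := h
    set M' := M.preimage (shiftEdge N l) (shiftEdge N l).injective.injOn
    have hsub : M'.map (shiftEdge N l) ⊆ M := by
      intro e he
      obtain ⟨e', he', rfl⟩ := Finset.mem_map.1 he
      exact Finset.mem_preimage.1 he'
    have hcase : ∀ e ∈ M, (∃ s, e = newEdge N l s) ∨ e ∈ M'.map (shiftEdge N l) := by
      intro e he
      refine (eq_newEdge_or_shiftEdge e).imp_right ?_
      rintro ⟨e', rfl⟩
      exact Finset.mem_map_of_mem _ (Finset.mem_preimage.2 he)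
    have hM' : IsBipartiteMatching l M' := isBipartiteMatching_map_shiftEdge.1
      ⟨fun e he => h1 e (hsub he), h2.mono (Finset.coe_subset.2 hsub),
        h3.mono (Finset.coe_subset.2 hsub)⟩
    by_cases h0 : ∃ s, newEdge N l s ∈ M
    · obtain ⟨s, hs⟩ := h0
      have : M = insert (newEdge N l s) (M'.map (shiftEdge N l)) := by
        refine Finset.Subset.antisymm (fun e he => ?_) (Finset.insert_subset hs hsub)
        rcases hcase e he with ⟨t, rfl⟩ | h
        · exact Finset.mem_insert.2 (Or.inl (h2 he hs rfl))
        · exact Finset.mem_insert_of_mem h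
      rw [this, Finset.image_insert, image_snd_map_shiftEdge]
      refine (ih hM').use (h1 _ hs) ?_
      rw [← image_snd_map_shiftEdge N, Finset.mem_image]
      rintro ⟨e, he, hes⟩
      have := h3 (hsub he) hs hes
      obtain ⟨e, -, rfl⟩ := Finset.mem_map.1 he
      exact shiftEdge_fst_ne e s (congrArg Prod.fst this)
    · have : M = M'.map (shiftEdge N l) := by
        refine Finset.Subset.antisymm (fun e he => ?_) hsub
        rcases hcase e he with ⟨t, rfl⟩ | h
        exacts [absurd ⟨t, he⟩ h0, h]
      rw [this, image_snd_map_shiftEdge]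
      exact (ih hM').skip N

theorem HasSize.exists_matches {d n : ℕ} {l : History d} (h : HasSize l n) :
    ∃ Z, Matches l Z ∧ Z.card = n := by
  obtain ⟨M, hM, rfl⟩ := h.1
  exact ⟨_, hM.matches, Finset.card_image_of_injOn hM.2.2⟩

theorem Matches.hasSize {d : ℕ} {l : History d} (h : Matches l Finset.univ) : HasSize l d := by
  obtain ⟨M, hM, hc⟩ := h.exists_isBipartiteMatching
  refine ⟨⟨M, hM, ?_⟩, ?_⟩
  · rw [← Finset.card_image_of_injOn hM.2.2, hc, Finset.card_univ, Fintype.card_fin]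
  rintro _ ⟨M', hM', rfl⟩
  have := Finset.card_le_univ (M'.image Prod.snd)
  rwa [Finset.card_image_of_injOn hM'.2.2, Fintype.card_fin] at this

/-- `Owes l B q`: the servers outside `B` are matched to tasks of `l`, and the remaining tasks of
`l`, of which there are `q`, can be matched to arbitrary servers of `B`, as far as these reach. -/
inductive Owes {d : ℕ} : History d → Finset (Fin d) → ℕ → Prop
  | nil : Owes [] Finset.univ 0
  | skip {l : History d} {B N : Finset (Fin d)} {q : ℕ} :
      Owes l B q → B ⊆ N → Owes (N :: l) B (q + 1)
  | use {l : History d} {B N : Finset (Fin d)} {q : ℕ} {s : Fin d} :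
      Owes l B q → s ∈ B → s ∈ N → Owes (N :: l) (B.erase s) q

theorem Owes.pay {d : ℕ} {l : History d} {B : Finset (Fin d)} {q : ℕ} {s : Fin d}
    (h : Owes l B q) (hs : s ∈ B) (hq : 0 < q) : Owes l (B.erase s) (q - 1) := by
  induction h with
  | nil => omega
  | skip h hN _ => exact h.use hs (hN hs)
  | @use l B N q t h ht htN ih =>
    rw [Finset.erase_right_comm]
    rw [Finset.mem_erase] at hs
    exact (ih hs.2 hq).use (Finset.mem_erase.2 ⟨hs.1.symm, ht⟩) htN

theorem Owes.pay_finset {d : ℕ} {l : History d} {B : Finset (Fin d)} {q : ℕ}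
    (h : Owes l B q) {W : Finset (Fin d)} (hW : W ⊆ B) (hq : W.card ≤ q) :
    Owes l (B \ W) (q - W.card) := by
  induction W using Finset.induction_on with
  | empty => simpa using h
  | @insert a W ha ih =>
    rw [Finset.card_insert_of_notMem ha] at hq ⊢
    rw [Finset.insert_subset_iff] at hW
    have := (ih hW.2 (by omega)).pay (s := a) (Finset.mem_sdiff.2 ⟨hW.1, ha⟩) (by omega)
    rw [Finset.sdiff_insert, ← Nat.sub_sub]
    exact this

theorem Owes.matches {d : ℕ} {l : History d} {B : Finset (Fin d)} {q : ℕ} (h : Owes l B q) :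
    Matches l Bᶜ := by
  induction h with
  | nil => simpa using Matches.nil
  | skip _ _ ih => exact ih.skip _
  | use _ hs hsN ih =>
    rw [Finset.compl_erase]
    exact ih.use hsN (by simpa using hs)

theorem Owes.length_add_card {d : ℕ} {l : History d} {B : Finset (Fin d)} {q : ℕ}
    (h : Owes l B q) : l.length + B.card = d + q := by
  induction h with
  | nil => simp
  | skip _ _ ih => simp only [List.length_cons]; omega
  | use _ hs _ ih =>
    have := Finset.card_erase_add_one hs
    simp only [List.length_cons]
    omega

/-! ### The sets that an algorithm maintains -/

namespace LazyAlgorithm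

variable {α : ℕ∞} (A : LazyAlgorithm α) {d : ℕ}

theorem run_cons (N : Finset (Fin d)) (l : History d) :
    A.run (N :: l) = A.assign d l N :: (A.run l).map (fun M => M \ A.assign d l N) := rfl

theorem length_run (l : History d) : (A.run l).length = l.length := by
  induction l with
  | nil => rfl
  | cons N l ih => simp [run_cons, ih]

theorem run_pairwise_disjoint (l : History d) : (A.run l).Pairwise Disjoint := by
  induction l with
  | nil => exact List.Pairwise.nil
  | cons N l ih => exact pairwise_disjoint_cons_map_sdiff ih _

theorem card_le_of_mem_run (l : History d) : ∀ M ∈ A.run l, (M.card : ℕ∞) ≤ α := by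
  induction l with
  | nil => simp [run]
  | cons N l ih =>
    intro M hM
    rw [run_cons, List.mem_cons, List.mem_map] at hM
    rcases hM with rfl | ⟨M', hM', rfl⟩
    · exact A.card_assign_le d l N
    · exact le_trans (by exact_mod_cast Finset.card_le_card Finset.sdiff_subset) (ih M' hM')

end LazyAlgorithm

/-! ### Builder's strategy -/

theorem listUnion_perm {β : Type*} [DecidableEq β] {L L' : List (Finset β)} (h : L.Perm L') :
    listUnion L = listUnion L' := by
  ext s
  simp only [mem_listUnion, h.mem_iff]

theorem listUnion_erase {β : Type*} [DecidableEq β] {L : List (Finset β)}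
    (hL : L.Pairwise Disjoint) {M : Finset β} (hM : M ∈ L) :
    listUnion (L.erase M) = listUnion L \ M := by
  have hp := List.perm_cons_erase hM
  have hd := (hp.pairwise_iff fun h => h.symm).1 hL
  rw [listUnion_perm hp, listUnion_cons, Finset.union_sdiff_cancel_left]
  exact disjoint_listUnion (List.pairwise_cons.1 hd).1

/-- The total value of tasks with the sets `L`, when increments are frozen from `i` on. -/
noncomputable def totalValue {β : Type*} (i : ℕ) (L : List (Finset β)) : ℝ :=
  (L.map fun M => taskValue i M.card).sum

/-- The number of servers in the members of `L` that have more than `i` elements. -/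
def bigCard {β : Type*} (i : ℕ) (L : List (Finset β)) : ℕ :=
  (L.map fun M => if i < M.card then M.card else 0).sum

theorem totalValue_erase {β : Type*} [DecidableEq β] (i : ℕ) {L : List (Finset β)} {M : Finset β}
    (hM : M ∈ L) : totalValue i L = taskValue i M.card + totalValue i (L.erase M) := by
  rw [totalValue, totalValue, ((List.perm_cons_erase hM).map _).sum_eq, List.map_cons,
    List.sum_cons]

theorem bigCard_erase {β : Type*} [DecidableEq β] {i : ℕ} {L : List (Finset β)} {M : Finset β}
    (hM : M ∈ L) (hi : i < M.card) : bigCard i L = M.card + bigCard i (L.erase M) := by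
  rw [bigCard, bigCard, ((List.perm_cons_erase hM).map _).sum_eq, List.map_cons,
    List.sum_cons, if_pos hi]

theorem bigCard_eq_zero {β : Type*} {i : ℕ} {L : List (Finset β)} (h : ∀ M ∈ L, M.card ≤ i) :
    bigCard i L = 0 := by
  rw [bigCard, List.sum_eq_zero_iff]
  intro x hx
  obtain ⟨M, hM, rfl⟩ := List.mem_map.1 hx
  exact if_neg (by simpa using h M hM)

theorem card_le_add_bigCard {β : Type*} [DecidableEq β] (i : ℕ) {L : List (Finset β)}
    {M : Finset β} (hM : M ∈ L) (S : Finset β) :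
    M.card ≤ 2 * i + bigCard i (S :: L.map fun M => M \ S) := by
  have h1 : M.card ≤ S.card + (M \ S).card := by
    have := Finset.card_sdiff_add_card_inter M S
    have := Finset.card_le_card (Finset.inter_subset_right (s₁ := M) (s₂ := S))
    omega
  have h2 : (if i < (M \ S).card then (M \ S).card else 0) ≤ bigCard i (L.map fun M => M \ S) :=
    List.le_sum_of_mem (List.mem_map.2 ⟨M \ S, List.mem_map.2 ⟨M, hM, rfl⟩, rfl⟩)
  have h3 : bigCard i (S :: L.map fun M => M \ S)
      = (if i < S.card then S.card else 0) + bigCard i (L.map fun M => M \ S) := by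
    simp [bigCard]
  split_ifs at h2 h3 <;> omega

theorem totalValue_zero_left {β : Type*} (L : List (Finset β)) :
    totalValue 0 L = L.length := by
  have : ∀ l, taskValue 0 l = 1 := fun l => by simp [taskValue]
  simp [totalValue, this]

theorem totalValue_succ_left {β : Type*} {i : ℕ} {L : List (Finset β)}
    (h : ∀ M ∈ L, M.card ≤ i + 1) : totalValue (i + 1) L = totalValue i L := by
  rw [totalValue, totalValue]
  congr 1
  exact List.map_congr_left fun M hM => taskValue_succ_left (h M hM)

/-- Removing a set of servers lowers the total value by at most the frozen increment for each. -/
theorem totalValue_le_map_sdiff {β : Type*} [DecidableEq β] (i : ℕ) {L : List (Finset β)}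
    (hL : L.Pairwise Disjoint) (S : Finset β) :
    totalValue i L
      ≤ totalValue i (L.map fun M => M \ S) + (listUnion L ∩ S).card * valueSlope i := by
  rw [← listUnion_map_inter, card_listUnion (pairwise_disjoint_map_inter hL S)]
  clear hL
  induction L with
  | nil => simp [totalValue]
  | cons M L ih =>
    have h1 := taskValue_add_le i (M \ S).card (M ∩ S).card
    rw [Finset.card_sdiff_add_card_inter] at h1
    simp only [totalValue, List.map_cons, List.sum_cons] at ih ⊢
    push_cast at *
    linarith

/-- A position of the game in which `act` lists the sets of the tasks that Builder still exploits,
`F` is the set of servers not yet touched, and Builder owes a matching partner to `q` tasks, each of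
which is adjacent to all the servers in play. All other servers have been given up: they are
matched to tasks, and no later task is adjacent to them. -/
structure Position {α : ℕ∞} (A : LazyAlgorithm α) {d : ℕ} (l : History d) (F : Finset (Fin d))
    (act : List (Finset (Fin d))) (q : ℕ) : Prop where
  sublist : act.Sublist (A.run l)
  disjoint : ∀ M ∈ act, Disjoint F M
  owes : Owes l (F ∪ listUnion act) q

namespace Position

variable {α : ℕ∞} {A : LazyAlgorithm α} {d : ℕ} {l : History d} {F : Finset (Fin d)}
  {act : List (Finset (Fin d))} {q : ℕ}

theorem init (A : LazyAlgorithm α) (d : ℕ) : Position A [] (Finset.univ : Finset (Fin d)) [] 0 :=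
  ⟨List.Sublist.slnil, by simp, by simpa using Owes.nil⟩

theorem pairwise (h : Position A l F act q) : act.Pairwise Disjoint :=
  (A.run_pairwise_disjoint l).sublist h.sublist

/-- Builder presents a task that is adjacent to all the servers in play. -/
theorem present (h : Position A l F act q) :
    ∃ (l' : History d) (S : Finset (Fin d)), S ⊆ F ∪ listUnion act ∧ (S.card : ℕ∞) ≤ α ∧
      Position A l' (F \ S) (S :: act.map fun M => M \ S) (q + 1) := by
  set N := F ∪ listUnion act with hN
  have hS : A.assign d l N ⊆ N := A.assign_subset d l N
  refine ⟨N :: l, A.assign d l N, hS, A.card_assign_le d l N, ?_, ?_, ?_⟩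
  · rw [LazyAlgorithm.run_cons]
    exact (h.sublist.map _).cons_cons _
  · intro M hM
    rw [List.mem_cons, List.mem_map] at hM
    rcases hM with rfl | ⟨M, hM, rfl⟩
    · exact Finset.sdiff_disjoint
    · exact (h.disjoint M hM).mono Finset.sdiff_subset Finset.sdiff_subset
  · have : F \ A.assign d l N ∪ listUnion (A.assign d l N :: act.map fun M => M \ A.assign d l N)
        = N := by
      rw [listUnion_cons, listUnion_map_sdiff, Finset.union_left_comm,
        ← Finset.union_sdiff_distrib, Finset.union_sdiff_of_subset hS]
    rw [this]
    exact h.owes.skip subset_rfl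

/-- Builder gives up an exploited task, and matches its servers to tasks that are owed a partner. -/
theorem give_up (h : Position A l F act q) {M : Finset (Fin d)} (hM : M ∈ act)
    (hq : M.card ≤ q) : Position A l F (act.erase M) (q - M.card) := by
  refine ⟨List.erase_sublist.trans h.sublist,
    fun M' hM' => h.disjoint M' (List.mem_of_mem_erase hM'), ?_⟩
  have : F ∪ listUnion (act.erase M) = (F ∪ listUnion act) \ M := by
    rw [listUnion_erase h.pairwise hM, Finset.union_sdiff_distrib,
      Finset.sdiff_eq_self_of_disjoint (h.disjoint M hM)]
  rw [this]
  exact h.owes.pay_finset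
    (fun s hs => Finset.mem_union_right _ (mem_listUnion.2 ⟨M, hM, hs⟩)) hq

theorem give_up_free (h : Position A l F act q) {s : Fin d} (hs : s ∈ F) (hq : 0 < q) :
    Position A l (F.erase s) act (q - 1) := by
  refine ⟨h.sublist, fun M hM => (h.disjoint M hM).mono_left (Finset.erase_subset _ _), ?_⟩
  have : F.erase s ∪ listUnion act = (F ∪ listUnion act).erase s := by
    rw [Finset.erase_union_distrib, Finset.erase_eq_of_notMem (s := listUnion act)]
    exact Finset.disjoint_left.1 (disjoint_listUnion h.disjoint) hs
  rw [this]
  exact h.owes.pay (Finset.mem_union_left _ hs) hq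

end Position

theorem countP_map_sdiff_lt {β : Type*} [DecidableEq β] {L : List (Finset β)} {s : β}
    (hs : {s} ∈ L) : (L.map fun M => M \ {s}).countP (fun M => M ≠ ∅)
      < L.countP (fun M => M ≠ ∅) := by
  have hle : ∀ L : List (Finset β), (L.map fun M => M \ {s}).countP (fun M => M ≠ ∅)
      ≤ L.countP (fun M => M ≠ ∅) := by
    intro L
    rw [List.countP_map]
    refine List.countP_mono_left fun M _ h => ?_
    simp only [Function.comp, decide_eq_true_eq] at h ⊢
    rintro rfl
    simp at h
  induction L with
  | nil => simp at hs
  | cons M L ih =>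
    rw [List.map_cons, List.countP_cons, List.countP_cons]
    by_cases hM : M = {s}
    · subst hM
      have := hle L
      simp only [sdiff_self, Finset.bot_eq_empty]
      simp
      simpa using this
    · have h1 := ih (by simpa [Ne.symm hM] using hs)
      have h2 := hle [M]
      simp only [List.map_cons, List.map_nil, List.countP_cons, List.countP_nil] at h2
      omega

theorem LazyAlgorithm.matched_singleton_le {α : ℕ∞} (A : LazyAlgorithm α) {d : ℕ}
    {l : History d} {s : Fin d} (hs : {s} ∈ A.run l) : A.matched ({s} :: l) ≤ A.matched l := by
  rw [matched, matched, run_cons]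
  rcases Finset.subset_singleton_iff.1 (A.assign_subset d l {s}) with h | h
  · simp [h]
  · rw [h, List.countP_cons]
    have := countP_map_sdiff_lt hs
    simp only [ne_eq, Finset.singleton_ne_empty, not_false_eq_true, decide_true, if_true] at this ⊢
    omega

/-- When no exploited task holds more than one server, Builder presents, for each server in play,
a task adjacent to this server only. -/
theorem Position.finish {α : ℕ∞} {A : LazyAlgorithm α} {d : ℕ} {l : History d}
    {act : List (Finset (Fin d))} {q : ℕ} (h : Position A l ∅ act q)
    (hact : ∀ M ∈ act, M.card ≤ 1) :
    ∃ l' : History d, HasSize l' d ∧ A.matched l' + act.length ≤ d + q := by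
  have hB := h.owes
  rw [Finset.empty_union] at hB
  have key : ∀ T ⊆ listUnion act, ∃ l' : History d, A.matched l' ≤ A.matched l ∧
      Owes l' (listUnion act \ T) q ∧ ∀ s ∈ listUnion act \ T, {s} ∈ A.run l' := by
    intro T
    induction T using Finset.induction_on with
    | empty =>
      refine fun _ => ⟨l, le_rfl, by simpa using hB, fun s hs => ?_⟩
      obtain ⟨M, hM, hsM⟩ := mem_listUnion.1 (by simpa using hs)
      have : M = {s} := by
        refine (Finset.eq_of_subset_of_card_le (Finset.singleton_subset_iff.2 hsM) ?_).symm
        simpa using hact M hM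
      exact this ▸ h.sublist.subset hM
    | @insert a T ha ih =>
      intro hT
      rw [Finset.insert_subset_iff] at hT
      obtain ⟨l', h1, h2, h3⟩ := ih hT.2
      have haB : a ∈ listUnion act \ T := Finset.mem_sdiff.2 ⟨hT.1, ha⟩
      rw [Finset.sdiff_insert]
      refine ⟨{a} :: l', (A.matched_singleton_le (h3 a haB)).trans h1,
        h2.use haB (Finset.mem_singleton_self a), fun s hs => ?_⟩
      rw [Finset.mem_erase] at hs
      rw [LazyAlgorithm.run_cons]
      refine List.mem_cons_of_mem _ (List.mem_map.2 ⟨{s}, h3 s hs.2, ?_⟩)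
      refine Finset.sdiff_eq_self_of_disjoint (Finset.disjoint_singleton_left.2 fun hsS => ?_)
      exact hs.1 (Finset.mem_singleton.1 (A.assign_subset d l' {a} hsS))
  obtain ⟨l', h1, h2, -⟩ := key _ subset_rfl
  rw [sdiff_self] at h2
  refine ⟨l', Matches.hasSize (by simpa using h2.matches), ?_⟩
  have hlen := hB.length_add_card
  rw [card_listUnion h.pairwise, ← A.length_run] at hlen
  have hcount := List.length_eq_countP_add_countP (fun M : Finset (Fin d) => M ≠ ∅)
    (l := A.run l)
  have hsub := h.sublist.countP_le (p := fun M => ¬ (decide (M ≠ ∅) = true))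
  have hact' : act.length ≤ (act.map Finset.card).sum
      + act.countP (fun M => ¬ (decide (M ≠ ∅) = true)) := by
    clear * -
    induction act with
    | nil => simp
    | cons M act ih =>
      rw [List.length_cons, List.map_cons, List.sum_cons, List.countP_cons]
      rcases Finset.eq_empty_or_nonempty M with rfl | hM
      · simp at ih ⊢; omega
      · have := hM.card_pos
        omega
  have hdef : A.matched l = (A.run l).countP (fun M => M ≠ ∅) := rfl
  omega

/-- Builder's stage `i` splits the exploited tasks with more than `i` servers; `hexit` says what is
achieved once there are none left. The bound on `q` says that the large sets can provide partners
for all but `Q` of the tasks that are owed one, so that at most `Q` remain at the end. -/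
theorem Position.split {α : ℕ∞} {A : LazyAlgorithm α} {d : ℕ} {i Q : ℕ} (hQ : 2 * i ≤ Q) {C : ℝ}
    (hexit : ∀ (l : History d) (act : List (Finset (Fin d))) (q : ℕ), Position A l ∅ act q →
      (∀ M ∈ act, M.card ≤ i) → q ≤ Q → ∃ l' : History d, HasSize l' d ∧
        (A.matched l' : ℝ) ≤ d - totalValue i act + share (i + 1) * q + C)
    {l : History d} {act : List (Finset (Fin d))} {q : ℕ} (h : Position A l ∅ act q)
    (hq : q ≤ bigCard i act + Q) :
    ∃ l' : History d, HasSize l' d ∧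
      (A.matched l' : ℝ) ≤ d - totalValue i act + share (i + 1) * q + C := by
  induction hm : (listUnion act).card + ((listUnion act).card - q) using Nat.strong_induction_on
    generalizing l act q with
  | _ m ih =>
    subst hm
    by_cases hbig : ∃ M ∈ act, i < M.card
    · by_cases hpay : ∃ M ∈ act, i < M.card ∧ M.card ≤ q
      · obtain ⟨M, hM, hiM, hMq⟩ := hpay
        have hsub : M ⊆ listUnion act := fun s hs => mem_listUnion.2 ⟨M, hM, hs⟩
        have hcard := Finset.card_sdiff_of_subset hsub
        have hle := Finset.card_le_card hsub
        rw [← listUnion_erase h.pairwise hM] at hcard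
        have hb := bigCard_erase hM hiM
        obtain ⟨l', h1, h2⟩ := ih _ (by omega) (h.give_up hM hMq) (by omega) rfl
        refine ⟨l', h1, h2.trans ?_⟩
        rw [totalValue_erase i hM, Nat.cast_sub hMq]
        have := taskValue_le_of_lt hiM
        linarith
      · obtain ⟨M, hM, hiM⟩ := hbig
        have hqM : q < M.card := by
          by_contra hcon
          exact hpay ⟨M, hM, hiM, not_lt.1 hcon⟩
        have hle := Finset.card_le_card
          (show M ⊆ listUnion act from fun s hs => mem_listUnion.2 ⟨M, hM, hs⟩)
        obtain ⟨l', S, hS, -, hpos⟩ := h.present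
        rw [Finset.empty_union] at hS
        rw [Finset.empty_sdiff] at hpos
        have hunion : listUnion (S :: act.map fun M => M \ S) = listUnion act := by
          rw [listUnion_cons, listUnion_map_sdiff, Finset.union_sdiff_of_subset hS]
        -- The set `M` is split in two, so at most `2 * i` of its servers leave the large sets.
        have hb := card_le_add_bigCard i hM S
        obtain ⟨l'', h1, h2⟩ := ih _ (by rw [hunion]; omega) hpos (by omega) rfl
        refine ⟨l'', h1, h2.trans ?_⟩
        have h3 := totalValue_le_map_sdiff i h.pairwise S
        rw [Finset.inter_eq_right.2 hS] at h3
        have h4 := le_taskValue i S.card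
        have h5 : totalValue i (S :: act.map fun M => M \ S)
            = taskValue i S.card + totalValue i (act.map fun M => M \ S) := by
          simp [totalValue]
        rw [h5]
        push_cast
        linarith
    · have hsmall : ∀ M ∈ act, M.card ≤ i := fun M hM => by
        by_contra hcon
        exact hbig ⟨M, hM, not_le.1 hcon⟩
      rw [bigCard_eq_zero hsmall, zero_add] at hq
      exact hexit l act q h hsmall hq

/-- All the stages of Builder's strategy from stage `i` down to the end. Each passage to the next
stage raises the price of the at most `Q` partners that are still owed. -/
theorem Position.exploit {α : ℕ∞} {A : LazyAlgorithm α} {d : ℕ} {Q : ℕ} (i : ℕ) (hQ : 2 * i ≤ Q)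
    {l : History d} {act : List (Finset (Fin d))} {q : ℕ} (h : Position A l ∅ act q)
    (hq : q ≤ Q) :
    ∃ l' : History d, HasSize l' d ∧
      (A.matched l' : ℝ) ≤ d - totalValue i act + share (i + 1) * q + i * Q := by
  induction i generalizing l act q with
  | zero =>
    refine h.split hQ (fun l act q h hact _ => ?_) (by omega)
    obtain ⟨l', h1, h2⟩ := h.finish fun M hM => (hact M hM).trans zero_le_one
    refine ⟨l', h1, ?_⟩
    rw [totalValue_zero_left]
    have : (A.matched l' : ℝ) + act.length ≤ d + q := by exact_mod_cast h2
    simp only [zero_add, share_one, CharP.cast_eq_zero]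
    linarith
  | succ i ih =>
    refine h.split hQ (fun l act q h hact hq => ?_) (by omega)
    obtain ⟨l', h1, h2⟩ := ih (by omega) h hq
    refine ⟨l', h1, h2.trans ?_⟩
    rw [totalValue_succ_left hact]
    have h3 : share (i + 1) * (q : ℝ) ≤ Q := by
      have h4 : (q : ℝ) ≤ Q := by exact_mod_cast hq
      exact (mul_le_of_le_one_left q.cast_nonneg (share_le_one _)).trans h4
    have h5 : 0 ≤ share (i + 1 + 1) * (q : ℝ) := mul_nonneg (share_pos _).le q.cast_nonneg
    push_cast
    linarith

/-- The opening of Builder's strategy: as long as there are untouched servers, each worth `ρ`,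
every new task is matched to one of them which Scheduler did not take. -/
theorem Position.opening {α : ℕ∞} {A : LazyAlgorithm α} {d : ℕ} {i : ℕ} {ρ : ℝ}
    (hslope : valueSlope i ≤ ρ)
    (hρ : ∀ j : ℕ, (j : ℕ∞) ≤ α → (j + 1) * ρ ≤ taskValue i j)
    {l : History d} {F : Finset (Fin d)} {act : List (Finset (Fin d))} (h : Position A l F act 0) :
    ∃ l' : History d, HasSize l' d ∧
      (A.matched l' : ℝ) ≤ d - totalValue i act - ρ * F.card + (1 + i * (2 * i + 1 : ℕ)) := by
  have hρ0 : 0 ≤ ρ := (valueSlope_nonneg i).trans hslope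
  induction hm : F.card using Nat.strong_induction_on generalizing l F act with
  | _ m ih =>
    subst hm
    rcases Finset.eq_empty_or_nonempty F with rfl | hF
    · obtain ⟨l', h1, h2⟩ := h.exploit (Q := 2 * i + 1) i (by omega) (by omega)
      refine ⟨l', h1, h2.trans ?_⟩
      simp only [CharP.cast_eq_zero, Finset.card_empty]
      linarith
    · obtain ⟨l', S, hS, hSα, hpos⟩ := h.present
      have h3 := totalValue_le_map_sdiff i h.pairwise S
      have h4 := hρ S.card hSα
      have h5 : totalValue i (S :: act.map fun M => M \ S)
          = taskValue i S.card + totalValue i (act.map fun M => M \ S) := by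
        simp [totalValue]
      have hcard : ((F ∩ S).card : ℝ) + (listUnion act ∩ S).card = S.card := by
        rw [← Nat.cast_add, ← Finset.card_union_of_disjoint, ← Finset.union_inter_distrib_right,
          Finset.inter_eq_right.2 hS]
        exact (disjoint_listUnion h.disjoint).mono Finset.inter_subset_left
          Finset.inter_subset_left
      have hF' : ((F \ S).card : ℝ) + (F ∩ S).card = F.card := by
        exact_mod_cast Finset.card_sdiff_add_card_inter F S
      have h6 : ((listUnion act ∩ S).card : ℝ) * valueSlope i ≤ (listUnion act ∩ S).card * ρ :=
        mul_le_mul_of_nonneg_left hslope (Nat.cast_nonneg _)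
      have hgain : totalValue i act + ρ * F.card + ρ
          ≤ totalValue i (S :: act.map fun M => M \ S) + ρ * (F \ S).card := by
        rw [h5]
        rw [← hcard] at h4
        rw [← hF']
        linarith
      rcases Finset.eq_empty_or_nonempty (F \ S) with hFS | ⟨s, hs⟩
      · rw [hFS] at hpos hgain
        obtain ⟨l'', h1, h2⟩ := hpos.exploit (Q := 2 * i + 1) i (by omega) (by omega)
        refine ⟨l'', h1, h2.trans ?_⟩
        have := share_le_one (i + 1)
        simp only [Finset.card_empty, CharP.cast_eq_zero, mul_zero, add_zero] at hgain
        push_cast at *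
        linarith
      · have hlt : ((F \ S).erase s).card < F.card :=
          (Finset.card_erase_lt_of_mem hs).trans_le (Finset.card_le_card Finset.sdiff_subset)
        obtain ⟨l'', h1, h2⟩ := ih _ hlt (hpos.give_up_free hs (by omega)) rfl
        refine ⟨l'', h1, h2.trans ?_⟩
        have : (((F \ S).erase s).card : ℝ) + 1 = (F \ S).card := by
          exact_mod_cast Finset.card_erase_add_one hs
        rw [← this] at hgain
        linarith

/-- Against every algorithm and for every `n`, Builder has a game of size `n` on `n` servers. -/
theorem exists_game_matched_le {α : ℕ∞} (A : LazyAlgorithm α) {i : ℕ} {ρ : ℝ}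
    (hslope : valueSlope i ≤ ρ)
    (hρ : ∀ j : ℕ, (j : ℕ∞) ≤ α → (j + 1) * ρ ≤ taskValue i j) (n : ℕ) :
    ∃ l : History n, HasSize l n ∧
      (A.matched l : ℝ) ≤ (1 - ρ) * n + (1 + i * (2 * i + 1 : ℕ)) := by
  obtain ⟨l, h1, h2⟩ := (Position.init A n).opening hslope hρ
  refine ⟨l, h1, h2.trans (le_of_eq ?_)⟩
  rw [totalValue, Finset.card_univ, Fintype.card_fin, List.map_nil, List.sum_nil]
  ring

/-! ### The outcome of a round of the balancing algorithm -/

section Round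

variable {α : ℕ∞} {d : ℕ} {ms : List (Finset (Fin d))} {N S : Finset (Fin d)}

theorem BalReach.subset (h : BalReach α ms N S) : S ⊆ N := by
  induction h with
  | start S hS _ => exact hS.trans (Finset.filter_subset _ _)
  | move S M s _ _ _ _ hav ih => exact Finset.insert_subset hav.1 ih

theorem BalReach.card_le (h : BalReach α ms N S) (hms : ∀ M ∈ ms, (M.card : ℕ∞) ≤ α) :
    (S.card : ℕ∞) ≤ α := by
  induction h with
  | start S _ hcard => exact hcard.trans_le (min_le_left _ _)
  | move S M s _ hM _ _ _ _ =>
    obtain ⟨M, hM', rfl⟩ := List.mem_map.1 hM.1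
    have h1 := hM.2.2
    have h2 := Finset.card_le_card (Finset.sdiff_subset (s := M) (t := S))
    have h3 := Finset.card_insert_le s S
    exact le_trans (by exact_mod_cast (by omega : (insert s S).card ≤ M.card)) (hms M hM')

theorem BalReach.stronglyAvailable_subset_or (h : BalReach α ms N S) :
    stronglyAvailable ms N ⊆ S ∨ α ≤ S.card := by
  induction h with
  | start S hS hcard =>
    rcases le_total α ((stronglyAvailable ms N).card : ℕ∞) with h | h
    · right
      rw [hcard, min_eq_left h]
    · left
      rw [min_eq_right h] at hcard
      exact (Finset.eq_of_subset_of_card_le hS (by exact_mod_cast hcard.ge)).ge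
  | move S M s _ _ _ _ _ ih =>
    refine ih.imp (fun h => h.trans (Finset.subset_insert _ _)) fun h => h.trans ?_
    exact_mod_cast Finset.card_le_card (Finset.subset_insert _ _)

/-- An earlier task that gave up servers still holds at least as many as the new task. The second
part, needed for the induction, records that donors are taken in the order of their sizes. -/
theorem BalReach.card_sdiff (h : BalReach α ms N S) (hms : ms.Pairwise Disjoint) :
    ∀ M ∈ ms, (M ∩ S).Nonempty → S.card ≤ (M \ S).card ∧
      ∀ M', IsDonor (ms.map (fun M'' => M'' \ S)) N S M' → M'.card ≤ (M \ S).card + 1 := by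
  induction h with
  | start S hS _ =>
    rintro M hM ⟨s, hs⟩
    rw [Finset.mem_inter] at hs
    exact absurd hs.1 ((Finset.mem_filter.1 (hS hs.2)).2 M hM)
  | move S D s _ hD hmax hs hav ih =>
    obtain ⟨D, hDms, rfl⟩ := List.mem_map.1 hD.1
    have hDcard := hD.2.2
    rw [Finset.mem_sdiff] at hs
    -- A donor for the enlarged set was already a donor before.
    have hdonor : ∀ M', IsDonor (ms.map (fun M'' => M'' \ insert s S)) N (insert s S) M' →
        M'.card ≤ (D \ S).card := by
      rintro _ ⟨hM', ⟨t, htM, htN, ht⟩, hcard⟩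
      obtain ⟨M', hM'ms, rfl⟩ := List.mem_map.1 hM'
      have hsub : M' \ insert s S ⊆ M' \ S :=
        Finset.sdiff_subset_sdiff subset_rfl (Finset.subset_insert _ _)
      have hle := Finset.card_le_card hsub
      have hcS := Finset.card_le_card (Finset.subset_insert s S)
      refine hle.trans (hmax _ ⟨List.mem_map.2 ⟨M', hM'ms, rfl⟩, ⟨t, hsub htM, htN, ?_⟩, by omega⟩)
      intro X hX hXt
      obtain ⟨X, hX', rfl⟩ := List.mem_map.1 hX
      refine ht _ (List.mem_map.2 ⟨X, hX', rfl⟩) ?_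
      rw [Finset.sdiff_insert, hXt, Finset.erase_eq_of_notMem]
      rw [Finset.mem_singleton]
      rintro rfl
      exact (Finset.mem_sdiff.1 htM).2 (Finset.mem_insert_self _ _)
    have hcard : (insert s S).card = S.card + 1 := Finset.card_insert_of_notMem hs.2
    intro M hM hMS
    by_cases hMD : M = D
    · subst hMD
      have hMs : (M \ insert s S).card + 1 = (M \ S).card := by
        rw [Finset.sdiff_insert]
        exact Finset.card_erase_add_one (Finset.mem_sdiff.2 hs)
      refine ⟨by omega, fun M' hM' => ?_⟩
      have := hdonor M' hM'
      omega
    · have hsM : s ∉ M := fun hsM => Finset.disjoint_left.1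
        ((eq_or_disjoint_of_mem hms hM hDms).resolve_left hMD) hsM hs.1
      have hMs : M \ insert s S = M \ S := by
        rw [Finset.sdiff_insert, Finset.erase_eq_of_notMem]
        exact fun h => hsM (Finset.mem_sdiff.1 h).1
      rw [Finset.inter_insert_of_notMem hsM] at hMS
      obtain ⟨-, h2⟩ := ih M hM hMS
      have h3 := h2 _ hD
      rw [hMs]
      refine ⟨by omega, fun M' hM' => ?_⟩
      have := hdonor M' hM'
      omega

/-- When the loop has ended, the servers that the new task could not get belong to sets which are
hardly larger than its own; if some of them belong to no set at all, the bound `α` is reached. -/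
theorem BalOutput.of_notMem (h : BalOutput α ms N S) {s : Fin d} (hsN : s ∈ N) (hsS : s ∉ S) :
    (∃ M ∈ ms, s ∈ M ∧ (M \ S).card ≤ S.card + 1) ∨ ((∀ M ∈ ms, s ∉ M) ∧ α ≤ S.card) := by
  by_cases hfree : ∀ M ∈ ms, s ∉ M
  · refine Or.inr ⟨hfree, h.1.stronglyAvailable_subset_or.resolve_left fun hsub => ?_⟩
    exact hsS (hsub (Finset.mem_filter.2 ⟨hsN, hfree⟩))
  · left
    push Not at hfree
    obtain ⟨M, hM, hsM⟩ := hfree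
    by_cases hav : Available (ms.map fun M' => M' \ S) N s
    · refine ⟨M, hM, hsM, ?_⟩
      by_contra hcon
      exact h.2 (M \ S) ⟨List.mem_map.2 ⟨M, hM, rfl⟩, ⟨s, Finset.mem_sdiff.2 ⟨hsM, hsS⟩, hav⟩,
        by omega⟩
    · have : ∃ M' ∈ ms, M' \ S = {s} := by
        by_contra hcon
        push Not at hcon
        refine hav ⟨hsN, fun X hX => ?_⟩
        obtain ⟨M', hM', rfl⟩ := List.mem_map.1 hX
        exact hcon M' hM'
      obtain ⟨M', hM', hMs⟩ := this
      refine ⟨M', hM', (Finset.mem_sdiff.1 (hMs.ge (Finset.mem_singleton_self s))).1, ?_⟩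
      rw [hMs, Finset.card_singleton]
      omega

end Round

/-! ### The potential of the balancing algorithm -/

/-- The weight of a server: `share i` if it belongs to a set of `ms` with `i` elements, and `ρ` if
it belongs to none. -/
noncomputable def weight {d : ℕ} (ρ : ℝ) : List (Finset (Fin d)) → Fin d → ℝ
  | [], _ => ρ
  | M :: ms, s => if s ∈ M then share M.card else weight ρ ms s

section Weight

variable {α : ℕ∞} {d : ℕ} {ms : List (Finset (Fin d))} {N S : Finset (Fin d)} {ρ : ℝ}

theorem weight_of_mem (hms : ms.Pairwise Disjoint) {M : Finset (Fin d)} (hM : M ∈ ms) {s : Fin d}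
    (hs : s ∈ M) : weight ρ ms s = share M.card := by
  induction ms with
  | nil => simp at hM
  | cons M' ms ih =>
    rw [List.pairwise_cons] at hms
    rw [weight]
    rcases List.mem_cons.1 hM with rfl | hM
    · rw [if_pos hs]
    · rw [if_neg, ih hms.2 hM]
      exact fun hs' => Finset.disjoint_left.1 (hms.1 M hM) hs' hs

theorem weight_of_notMem {s : Fin d} (hs : ∀ M ∈ ms, s ∉ M) : weight ρ ms s = ρ := by
  induction ms with
  | nil => rfl
  | cons M ms ih =>
    rw [weight, if_neg (hs M List.mem_cons_self), ih fun M hM => hs M (List.mem_cons_of_mem _ hM)]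

theorem weight_after_of_mem {s : Fin d} (hs : s ∈ S) :
    weight ρ (S :: ms.map fun M => M \ S) s = share S.card := by
  rw [weight, if_pos hs]

theorem weight_after_of_mem_sdiff (hms : ms.Pairwise Disjoint) {M : Finset (Fin d)} (hM : M ∈ ms)
    {s : Fin d} (hs : s ∈ M \ S) :
    weight ρ (S :: ms.map fun M => M \ S) s = share (M \ S).card :=
  weight_of_mem (pairwise_disjoint_cons_map_sdiff hms S)
    (List.mem_cons_of_mem _ (List.mem_map.2 ⟨M, hM, rfl⟩)) hs

theorem weight_after_of_notMem {s : Fin d} (hsS : s ∉ S) (hs : ∀ M ∈ ms, s ∉ M) :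
    weight ρ (S :: ms.map fun M => M \ S) s = ρ := by
  refine weight_of_notMem fun M hM => ?_
  rcases List.mem_cons.1 hM with rfl | hM
  · exact hsS
  · obtain ⟨M', hM', rfl⟩ := List.mem_map.1 hM
    exact fun h => hs M' hM' (Finset.mem_sdiff.1 h).1

/-- The properties of the weight `ρ` of an unassigned server that make the potential argument for
`α`-Bal work. -/
structure IsFreeWeight (α : ℕ∞) (ρ : ℝ) : Prop where
  valueSlope_le : ∀ j : ℕ, (j : ℕ∞) < α → valueSlope j ≤ ρ
  mul_share_le : ∀ j : ℕ, (j : ℕ∞) = α → j * share j ≤ (j + 1) * ρ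
  le_share : ∀ j : ℕ, (j : ℕ∞) ≤ α → ρ ≤ share j

theorem weight_le_weight_after (h : BalReach α ms N S) (hms : ms.Pairwise Disjoint)
    (hS : (S.card : ℕ∞) ≤ α) (hρ : IsFreeWeight α ρ) (s : Fin d) :
    weight ρ ms s ≤ weight ρ (S :: ms.map fun M => M \ S) s := by
  by_cases hfree : ∀ M ∈ ms, s ∉ M
  · rw [weight_of_notMem hfree]
    by_cases hs : s ∈ S
    · rw [weight_after_of_mem hs]
      exact hρ.le_share _ hS
    · rw [weight_after_of_notMem hs hfree]
  · push Not at hfree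
    obtain ⟨M, hM, hsM⟩ := hfree
    rw [weight_of_mem hms hM hsM]
    by_cases hs : s ∈ S
    · rw [weight_after_of_mem hs]
      have h1 := (h.card_sdiff hms M hM ⟨s, Finset.mem_inter.2 ⟨hsM, hs⟩⟩).1
      exact share_antitone (h1.trans (Finset.card_le_card Finset.sdiff_subset))
    · rw [weight_after_of_mem_sdiff hms hM (Finset.mem_sdiff.2 ⟨hsM, hs⟩)]
      exact share_antitone (Finset.card_le_card Finset.sdiff_subset)

/-- The increase of the weights of the servers of one earlier task is charged to the servers which
that task gives up. -/
theorem sum_weight_after_sub_le (h : BalReach α ms N S) (hms : ms.Pairwise Disjoint)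
    (hS : S.Nonempty) {M : Finset (Fin d)} (hM : M ∈ ms) :
    ∑ s ∈ M, (weight ρ (S :: ms.map fun M => M \ S) s - weight ρ ms s)
      ≤ (M ∩ S).card * (share S.card - valueSlope S.card) := by
  have h1 : ∑ s ∈ M \ S, (weight ρ (S :: ms.map fun M => M \ S) s - weight ρ ms s)
      = (M \ S).card * (share (M \ S).card - share M.card) := by
    rw [← nsmul_eq_mul, ← Finset.sum_const]
    refine Finset.sum_congr rfl fun s hs => ?_
    rw [weight_after_of_mem_sdiff hms hM hs, weight_of_mem hms hM (Finset.mem_sdiff.1 hs).1]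
  have h2 : ∑ s ∈ M ∩ S, (weight ρ (S :: ms.map fun M => M \ S) s - weight ρ ms s)
      = (M ∩ S).card * (share S.card - share M.card) := by
    rw [← nsmul_eq_mul, ← Finset.sum_const]
    refine Finset.sum_congr rfl fun s hs => ?_
    rw [weight_after_of_mem (Finset.mem_inter.1 hs).2,
      weight_of_mem hms hM (Finset.mem_inter.1 hs).1]
  rw [← Finset.sum_inter_add_sum_sdiff M S, h1, h2]
  have hcard := Finset.card_sdiff_add_card_inter M S
  rcases Finset.eq_empty_or_nonempty (M ∩ S) with he | hne
  · rw [he, Finset.card_empty, add_zero] at hcard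
    simp [he, hcard]
  · have h3 := mul_slope_le_sub hS.card_pos (M ∩ S).card (h.card_sdiff hms M hM hne).1
    rw [hcard] at h3
    have h4 : ((M \ S).card : ℝ) + (M ∩ S).card = M.card := by exact_mod_cast hcard
    rw [← h4] at h3
    linarith

theorem sum_univ_weight_after_sub_le (h : BalReach α ms N S) (hms : ms.Pairwise Disjoint)
    (hS : S.Nonempty) :
    ∑ s, (weight ρ (S :: ms.map fun M => M \ S) s - weight ρ ms s)
      ≤ (listUnion ms ∩ S).card * (share S.card - valueSlope S.card)
        + (S \ listUnion ms).card * (share S.card - ρ) := by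
  rw [← Finset.sum_add_sum_compl (listUnion ms)]
  refine add_le_add ?_ (le_of_eq ?_)
  · calc ∑ s ∈ listUnion ms, (weight ρ (S :: ms.map fun M => M \ S) s - weight ρ ms s)
        ≤ ∑ s ∈ listUnion ms, if s ∈ S then share S.card - valueSlope S.card else 0 := by
          rw [sum_listUnion hms, sum_listUnion hms]
          refine List.sum_le_sum fun M hM => ?_
          rw [Finset.sum_ite_mem, Finset.sum_const, nsmul_eq_mul]
          exact sum_weight_after_sub_le h hms hS hM
      _ = _ := by rw [Finset.sum_ite_mem, Finset.sum_const, nsmul_eq_mul]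
  · rw [← nsmul_eq_mul, ← Finset.sum_const, Finset.sdiff_eq_inter_compl, Finset.inter_comm,
      ← Finset.sum_ite_mem]
    refine Finset.sum_congr rfl fun s hs => ?_
    have hs' : ∀ M ∈ ms, s ∉ M := fun M hM hsM =>
      Finset.mem_compl.1 hs (mem_listUnion.2 ⟨M, hM, hsM⟩)
    rw [weight_of_notMem hs']
    split_ifs with hsS
    · rw [weight_after_of_mem hsS]
    · rw [weight_after_of_notMem hsS hs', sub_self]

/-- In a round in which the new task becomes matched, the total weight rises by no more than the
resulting weight of any of the servers adjacent to this task. -/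
theorem BalOutput.exists_weight_bound (h : BalOutput α ms N S) (hms : ms.Pairwise Disjoint)
    (hcard : ∀ M ∈ ms, (M.card : ℕ∞) ≤ α) (hρ : IsFreeWeight α ρ) (hS : S.Nonempty) :
    ∃ τ ≤ 1, (∀ s ∈ N, τ ≤ weight ρ (S :: ms.map fun M => M \ S) s) ∧
      ∀ H : Finset (Fin d), ∑ s ∈ H, weight ρ (S :: ms.map fun M => M \ S) s
        ≤ ∑ s ∈ H, weight ρ ms s + τ := by
  have hSα := h.1.card_le hcard
  have huniv := sum_univ_weight_after_sub_le (ρ := ρ) h.1 hms hS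
  have hsplit : ((listUnion ms ∩ S).card : ℝ) + (S \ listUnion ms).card = S.card := by
    rw [Finset.inter_comm, add_comm]
    exact_mod_cast Finset.card_sdiff_add_card_inter S (listUnion ms)
  have hle : ∀ H : Finset (Fin d),
      ∑ s ∈ H, weight ρ (S :: ms.map fun M => M \ S) s - ∑ s ∈ H, weight ρ ms s
        ≤ (listUnion ms ∩ S).card * (share S.card - valueSlope S.card)
        + (S \ listUnion ms).card * (share S.card - ρ) := by
    intro H
    rw [← Finset.sum_sub_distrib]
    refine le_trans (Finset.sum_le_sum_of_subset_of_nonneg (Finset.subset_univ H)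
      fun s _ _ => ?_) huniv
    exact sub_nonneg.2 (weight_le_weight_after h.1 hms hSα hρ s)
  rcases hSα.lt_or_eq with hlt | heq
  · refine ⟨share (S.card + 1), share_le_one _, fun s hs => ?_, fun H => ?_⟩
    · by_cases hsS : s ∈ S
      · rw [weight_after_of_mem hsS]
        exact share_succ_le _
      · rcases h.of_notMem hs hsS with ⟨M, hM, hsM, hMS⟩ | ⟨-, hα⟩
        · rw [weight_after_of_mem_sdiff hms hM (Finset.mem_sdiff.2 ⟨hsM, hsS⟩)]
          exact share_antitone hMS
        · exact absurd hα (not_le.2 hlt)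
    · have h1 := hρ.valueSlope_le _ hlt
      have h2 := share_mul_sub_slope hS.card_pos
      have h3 : ((S \ listUnion ms).card : ℝ) * valueSlope S.card
          ≤ (S \ listUnion ms).card * ρ := mul_le_mul_of_nonneg_left h1 (Nat.cast_nonneg _)
      have h4 := hle H
      rw [← h2]
      rw [← hsplit]
      linarith
  · refine ⟨ρ, by simpa using hρ.le_share 0 (by simp), fun s hs => ?_, fun H => ?_⟩
    · by_cases hsS : s ∈ S
      · rw [weight_after_of_mem hsS]
        exact hρ.le_share _ hSα
      · rcases h.of_notMem hs hsS with ⟨M, hM, hsM, hMS⟩ | ⟨hfree, -⟩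
        · rw [weight_after_of_mem_sdiff hms hM (Finset.mem_sdiff.2 ⟨hsM, hsS⟩)]
          refine hρ.le_share _ (le_trans ?_ (hcard M hM))
          exact_mod_cast Finset.card_le_card Finset.sdiff_subset
        · rw [weight_after_of_notMem hsS hfree]
    · -- No earlier set is large enough to give anything to a new set of size `α`.
      have hempty : listUnion ms ∩ S = ∅ := by
        refine Finset.eq_empty_of_forall_notMem fun s hs => ?_
        rw [Finset.mem_inter] at hs
        obtain ⟨M, hM, hsM⟩ := mem_listUnion.1 hs.1
        have hne : (M ∩ S).Nonempty := ⟨s, Finset.mem_inter.2 ⟨hsM, hs.2⟩⟩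
        have h1 := (h.1.card_sdiff hms M hM hne).1
        have h2 := Finset.card_sdiff_add_card_inter M S
        have h3 := hne.card_pos
        have h4 := hcard M hM
        rw [← heq] at h4
        have h5 : M.card ≤ S.card := by exact_mod_cast h4
        omega
      have h1 := hρ.mul_share_le _ heq
      have h4 := hle H
      rw [hempty, Finset.card_empty] at hsplit h4
      simp only [CharP.cast_eq_zero, zero_add, zero_mul] at hsplit h4
      rw [hsplit] at h4
      linarith

theorem BalOutput.weight_eq_one (h : BalOutput α ms N ∅) (hα : 1 ≤ α) (hms : ms.Pairwise Disjoint)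
    {s : Fin d} (hs : s ∈ N) : weight ρ ms s = 1 := by
  rcases h.of_notMem hs (Finset.notMem_empty s) with ⟨M, hM, hsM, hMS⟩ | ⟨-, hα'⟩
  · rw [weight_of_mem hms hM hsM]
    have : M.card = 1 := by
      have := Finset.card_pos.2 ⟨s, hsM⟩
      simp only [Finset.sdiff_empty, Finset.card_empty] at hMS
      omega
    rw [this, share_one]
  · simp only [Finset.card_empty, CharP.cast_eq_zero] at hα'
    exact absurd (hα.trans hα') (by simp)

end Weight

theorem LazyAlgorithm.IsBal.matched_cons {α : ℕ∞} {A : LazyAlgorithm α} (hA : A.IsBal) {d : ℕ}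
    (l : History d) (N : Finset (Fin d)) :
    A.matched (N :: l) = A.matched l + if A.assign d l N = ∅ then 0 else 1 := by
  rw [matched, matched, run_cons, List.countP_cons, List.countP_map]
  congr 1
  · refine List.countP_congr fun M hM => ?_
    simp only [Function.comp, decide_eq_true_eq]
    refine ⟨fun h hM => h (by simp [hM]), fun h hM' => ?_⟩
    rcases Finset.eq_empty_or_nonempty (M ∩ A.assign d l N) with he | hne
    · have := Finset.card_sdiff_add_card_inter M (A.assign d l N)
      rw [he, hM'] at this
      exact h (Finset.card_eq_zero.1 (by simpa using this.symm))
    · have h1 := ((hA d l N).1.card_sdiff (A.run_pairwise_disjoint l) M hM hne).1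
      rw [hM', Finset.card_empty] at h1
      have h2 := (hne.mono Finset.inter_subset_right).card_pos
      omega
  · simp

/-- The potential argument: unassigned servers weigh `ρ` at the start, and a server that is
matched to a task leaves the potential when this task is presented. If the task stays unmatched,
the server weighs `1` at that time. -/
theorem LazyAlgorithm.IsBal.sum_weight_le {α : ℕ∞} (hα : 1 ≤ α) {A : LazyAlgorithm α}
    (hA : A.IsBal) {ρ : ℝ} (hρ : IsFreeWeight α ρ) {d : ℕ} {l : History d} {Z : Finset (Fin d)}
    (h : Matches l Z) (H : Finset (Fin d)) (hH : Disjoint H Z) :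
    ∑ s ∈ H, weight ρ (A.run l) s + Z.card ≤ ρ * (Z.card + H.card) + A.matched l := by
  induction h generalizing H with
  | nil =>
    have : ∑ s ∈ H, weight ρ (A.run ([] : History d)) s = H.card * ρ := by
      rw [← nsmul_eq_mul, ← Finset.sum_const]
      rfl
    rw [this]
    simp [matched, run, mul_comm]
  | @skip l Z N _ ih =>
    have hi := ih H hH
    rw [hA.matched_cons, run_cons]
    have hout := hA d l N
    rcases Finset.eq_empty_or_nonempty (A.assign d l N) with he | hne
    · simpa [he, weight] using hi
    · obtain ⟨τ, hτ, -, hb⟩ := hout.exists_weight_bound (A.run_pairwise_disjoint l)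
        (A.card_le_of_mem_run l) hρ hne
      have := hb H
      rw [if_neg hne.ne_empty]
      push_cast
      linarith
  | @use l Z N s _ hsN hsZ ih =>
    rw [Finset.disjoint_insert_right] at hH
    have hi := ih (insert s H) (Finset.disjoint_insert_left.2 ⟨hsZ, hH.2⟩)
    rw [hA.matched_cons, run_cons, Finset.card_insert_of_notMem hsZ]
    rw [Finset.sum_insert hH.1, Finset.card_insert_of_notMem hH.1] at hi
    have hout := hA d l N
    rcases Finset.eq_empty_or_nonempty (A.assign d l N) with he | hne
    · rw [he] at hout ⊢
      rw [hout.weight_eq_one hα (A.run_pairwise_disjoint l) hsN] at hi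
      simp only [weight, Finset.notMem_empty, if_false, Finset.sdiff_empty, List.map_id', if_true]
      push_cast at *
      linarith
    · obtain ⟨τ, -, hN, hb⟩ := hout.exists_weight_bound (A.run_pairwise_disjoint l)
        (A.card_le_of_mem_run l) hρ hne
      have h1 := hb (insert s H)
      have h2 := hN s hsN
      rw [Finset.sum_insert hH.1, Finset.sum_insert hH.1] at h1
      rw [if_neg hne.ne_empty]
      push_cast at *
      linarith

theorem LazyAlgorithm.IsBal.le_matched {α : ℕ∞} (hα : 1 ≤ α) {A : LazyAlgorithm α}
    (hA : A.IsBal) {ρ : ℝ} (hρ : IsFreeWeight α ρ) {d n : ℕ} {l : History d} (h : HasSize l n) :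
    (1 - ρ) * n ≤ A.matched l := by
  obtain ⟨Z, hZ, rfl⟩ := h.exists_matches
  have := hA.sum_weight_le hα hρ hZ ∅ (Finset.disjoint_empty_left _)
  simp only [Finset.sum_empty, Finset.card_empty, CharP.cast_eq_zero] at this
  linarith

/-! ### Existence of balancing algorithms -/

theorem BalReach.exists_balOutput {α : ℕ∞} {d : ℕ} {ms : List (Finset (Fin d))}
    {N S : Finset (Fin d)} (h : BalReach α ms N S) : ∃ S', BalOutput α ms N S' := by
  classical
  induction hm : (N \ S).card using Nat.strong_induction_on generalizing S with
  | _ m ih =>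
    subst hm
    by_cases hD : ∃ M, IsDonor (ms.map (fun M' => M' \ S)) N S M
    · obtain ⟨M₀, hM₀⟩ := hD
      obtain ⟨M, hM, hmax⟩ := Finset.exists_max_image
        ((ms.map fun M' => M' \ S).toFinset.filter
          fun M => IsDonor (ms.map (fun M' => M' \ S)) N S M) Finset.card
        ⟨M₀, Finset.mem_filter.2 ⟨List.mem_toFinset.2 hM₀.1, hM₀⟩⟩
      have hMd := (Finset.mem_filter.1 hM).2
      obtain ⟨s, hsM, hs⟩ := hMd.2.1
      have hsS : s ∉ S := by
        obtain ⟨M', -, rfl⟩ := List.mem_map.1 hMd.1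
        exact (Finset.mem_sdiff.1 hsM).2
      refine ih _ ?_ (h.move S M s hMd (fun M' hM' => hmax M' (Finset.mem_filter.2
        ⟨List.mem_toFinset.2 hM'.1, hM'⟩)) hsM hs) rfl
      rw [Finset.sdiff_insert]
      exact Finset.card_erase_lt_of_mem (Finset.mem_sdiff.2 ⟨hs.1, hsS⟩)
    · exact ⟨S, h, fun M hM => hD ⟨M, hM⟩⟩

theorem exists_balOutput (α : ℕ∞) {d : ℕ} (ms : List (Finset (Fin d))) (N : Finset (Fin d)) :
    ∃ S, BalOutput α ms N S := by
  obtain ⟨k, hk⟩ := ENat.ne_top_iff_exists.1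
    (ne_top_of_le_ne_top (ENat.natCast_ne_top (stronglyAvailable ms N).card) (min_le_right α _))
  have hle : k ≤ (stronglyAvailable ms N).card := by
    exact_mod_cast hk.trans_le (min_le_right α ((stronglyAvailable ms N).card : ℕ∞))
  obtain ⟨S, hS, hcard⟩ := Finset.exists_subset_card_eq hle
  exact (BalReach.start S hS (by rw [hcard, hk])).exists_balOutput

open Classical in
/-- An outcome of a round of `α`-Bal. Its size is at most `α` if this holds for the sets in `ms`,
as is the case in every play; other lists `ms` get the junk value `∅`. -/
noncomputable def balChoice (α : ℕ∞) {d : ℕ} (ms : List (Finset (Fin d))) (N : Finset (Fin d)) :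
    Finset (Fin d) :=
  if h : ∃ S, BalOutput α ms N S ∧ (S.card : ℕ∞) ≤ α then h.choose else ∅

theorem balChoice_subset (α : ℕ∞) {d : ℕ} (ms : List (Finset (Fin d))) (N : Finset (Fin d)) :
    balChoice α ms N ⊆ N := by
  rw [balChoice]
  split_ifs with h
  · exact h.choose_spec.1.1.subset
  · exact Finset.empty_subset _

theorem card_balChoice_le (α : ℕ∞) {d : ℕ} (ms : List (Finset (Fin d))) (N : Finset (Fin d)) :
    ((balChoice α ms N).card : ℕ∞) ≤ α := by
  rw [balChoice]
  split_ifs with h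
  · exact h.choose_spec.2
  · simp

theorem balOutput_balChoice {α : ℕ∞} {d : ℕ} {ms : List (Finset (Fin d))}
    (hms : ∀ M ∈ ms, (M.card : ℕ∞) ≤ α) (N : Finset (Fin d)) :
    BalOutput α ms N (balChoice α ms N) := by
  have h : ∃ S, BalOutput α ms N S ∧ (S.card : ℕ∞) ≤ α := by
    obtain ⟨S, hS⟩ := exists_balOutput α ms N
    exact ⟨S, hS, hS.1.card_le hms⟩
  rw [balChoice, dif_pos h]
  exact h.choose_spec.1

/-- The sets maintained by the algorithm that chooses `balChoice` in each round. -/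
noncomputable def balRun (α : ℕ∞) {d : ℕ} : History d → List (Finset (Fin d))
  | [] => []
  | N :: past => balChoice α (balRun α past) N ::
      (balRun α past).map fun M => M \ balChoice α (balRun α past) N

/-- The algorithm that chooses `balChoice` in each round. -/
noncomputable def balAlgorithm (α : ℕ∞) : LazyAlgorithm α where
  assign _ past N := balChoice α (balRun α past) N
  assign_subset _ past N := balChoice_subset α (balRun α past) N
  card_assign_le _ past N := card_balChoice_le α (balRun α past) N

theorem run_balAlgorithm (α : ℕ∞) {d : ℕ} (l : History d) :
    (balAlgorithm α).run l = balRun α l := by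
  induction l with
  | nil => rfl
  | cons N l ih => rw [LazyAlgorithm.run_cons, ih]; rfl

theorem isBal_balAlgorithm (α : ℕ∞) : (balAlgorithm α).IsBal := by
  intro d past N
  have h := balOutput_balChoice ((balAlgorithm α).card_le_of_mem_run past) N
  rw [run_balAlgorithm] at h ⊢
  exact h

/-! ### Bounds for the values of the game -/

theorem LazyAlgorithm.IsBal.le_worstCase {α : ℕ∞} (hα : 1 ≤ α) {A : LazyAlgorithm α}
    (hA : A.IsBal) {ρ : ℝ} (hρ : IsFreeWeight α ρ) (n : ℕ) : (1 - ρ) * n ≤ A.worstCase n := by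
  obtain ⟨l, hl, -⟩ := exists_game_matched_le A (i := 0) (ρ := 0) (by simp)
    (fun j _ => by simp [taskValue]) n
  have hne : {v : ℕ | ∃ (d : ℕ) (l : History d), HasSize l n ∧ A.matched l = v}.Nonempty :=
    ⟨_, n, l, hl, rfl⟩
  obtain ⟨d, l, hl, h⟩ := Nat.sInf_mem hne
  change _ = A.worstCase n at h
  rw [← h]
  exact hA.le_matched hα hρ hl

theorem LazyAlgorithm.worstCase_le {α : ℕ∞} (A : LazyAlgorithm α) {i : ℕ} {ρ : ℝ}
    (hslope : valueSlope i ≤ ρ)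
    (hρ : ∀ j : ℕ, (j : ℕ∞) ≤ α → (j + 1) * ρ ≤ taskValue i j) (n : ℕ) :
    (A.worstCase n : ℝ) ≤ (1 - ρ) * n + (1 + i * (2 * i + 1 : ℕ)) := by
  obtain ⟨l, hl, h⟩ := exists_game_matched_le A hslope hρ n
  have hle : A.worstCase n ≤ A.matched l := Nat.sInf_le ⟨n, l, hl, rfl⟩
  exact le_trans (by exact_mod_cast hle) h

theorem LazyAlgorithm.worstCase_le_succ {α : ℕ∞} (A : LazyAlgorithm α) (n : ℕ) :
    A.worstCase n ≤ n + 1 := by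
  have := A.worstCase_le (i := 0) (ρ := 0) (by simp) (fun j _ => by simp [taskValue]) n
  have h : (A.worstCase n : ℝ) ≤ n + 1 := by simpa using this
  exact_mod_cast h

theorem bddAbove_worstCase (α : ℕ∞) (n : ℕ) :
    BddAbove {v : ℕ | ∃ A : LazyAlgorithm α, A.worstCase n = v} := by
  refine ⟨n + 1, ?_⟩
  rintro _ ⟨A, rfl⟩
  exact A.worstCase_le_succ n

theorem exists_worstCase_eq_lazyValue (α : ℕ∞) (n : ℕ) :
    ∃ A : LazyAlgorithm α, A.worstCase n = lazyValue α n := by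
  have hne : {v : ℕ | ∃ A : LazyAlgorithm α, A.worstCase n = v}.Nonempty :=
    ⟨_, balAlgorithm α, rfl⟩
  exact Nat.sSup_mem hne (bddAbove_worstCase α n)

theorem worstCase_le_lazyValue {α : ℕ∞} (A : LazyAlgorithm α) (n : ℕ) :
    A.worstCase n ≤ lazyValue α n :=
  le_csSup (bddAbove_worstCase α n) ⟨A, rfl⟩

theorem exists_worstCase_eq_balValue (α : ℕ∞) (n : ℕ) :
    ∃ A : LazyAlgorithm α, A.IsBal ∧ A.worstCase n = balValue α n := by
  have hne : {v : ℕ | ∃ A : LazyAlgorithm α, A.IsBal ∧ A.worstCase n = v}.Nonempty :=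
    ⟨_, balAlgorithm α, isBal_balAlgorithm α, rfl⟩
  exact Nat.sInf_mem hne

/-! ### The weights of unassigned servers -/

theorem lazyRatio_mono {j k : ℕ} (hj : 1 ≤ j) (hjk : j ≤ k) : lazyRatio j ≤ lazyRatio k := by
  induction k, hjk using Nat.le_induction with
  | base => rfl
  | succ k hk ih =>
    refine ih.trans ?_
    have h1 := share_mul_succ_sub k (hj.trans hk)
    have h2 := share_mul_sub_slope (hj.trans hk)
    have h3 := valueSlope_le_share_succ k
    rw [lazyRatio_eq, lazyRatio_eq, sub_le_sub_iff_left,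
      div_le_div_iff₀ (by positivity) (by positivity)]
    rw [sub_eq_iff_eq_add] at h1
    rw [h1]
    have h4 : (0 : ℝ) ≤ k := k.cast_nonneg
    push_cast
    nlinarith

theorem lazyRatio_le_limit {k : ℕ} (hk : 1 ≤ k) : lazyRatio k ≤ lazyRatioLimit :=
  ge_of_tendsto tendsto_lazyRatio <| by
    filter_upwards [eventually_ge_atTop k] with j hj using lazyRatio_mono hk hj

theorem valueSlope_le_one_sub_lazyRatio (k : ℕ) :
    valueSlope k ≤ 1 - lazyRatio (k + 1) := by
  have h := share_pos (k + 1)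
  rw [lazyRatio_eq, sub_sub_cancel, valueSlope, div_le_div_iff₀ (by positivity) (by positivity)]
  have : (0 : ℝ) ≤ k := k.cast_nonneg
  push_cast
  nlinarith

theorem isFreeWeight_natCast {k : ℕ} (hk : 1 ≤ k) :
    IsFreeWeight (k : ℕ∞) (1 - lazyRatio k) where
  valueSlope_le j hj := by
    have hj' : j < k := by exact_mod_cast hj
    obtain ⟨i, rfl⟩ := Nat.exists_eq_add_of_le' hk
    exact (valueSlope_mono (by omega)).trans (valueSlope_le_one_sub_lazyRatio i)
  mul_share_le j hj := by
    have hj' : j = k := by exact_mod_cast hj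
    subst hj'
    rw [lazyRatio_eq, sub_sub_cancel, add_comm (j : ℝ), mul_div_cancel₀ _ (by positivity)]
  le_share j hj := by
    have hj' : j ≤ k := by exact_mod_cast hj
    refine le_trans ?_ (share_antitone hj')
    rw [lazyRatio_eq, sub_sub_cancel, div_le_iff₀ (by positivity)]
    have := share_pos k
    linarith

theorem isFreeWeight_top : IsFreeWeight ⊤ (1 - lazyRatioLimit) where
  valueSlope_le j _ := by
    refine ge_of_tendsto (tendsto_one_sub_slope.const_sub 1) ?_
    filter_upwards [eventually_ge_atTop j] with i hi
    simpa using valueSlope_mono hi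
  mul_share_le j hj := absurd hj (ENat.natCast_ne_top j)
  le_share j _ := by
    rw [lazyRatioLimit, sub_sub_cancel]
    refine le_of_tendsto tendsto_share ?_
    filter_upwards [eventually_ge_atTop j] with i hi using share_antitone hi

theorem exists_isFreeWeight {α : ℕ∞} {k : ℕ} (hk : 1 ≤ k) (hα : (k : ℕ∞) ≤ α) :
    ∃ ρ, IsFreeWeight α ρ ∧ lazyRatio k ≤ 1 - ρ := by
  induction α with
  | top => exact ⟨_, isFreeWeight_top, by simpa using lazyRatio_le_limit hk⟩
  | coe j =>
    have hkj : k ≤ j := by exact_mod_cast hα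
    exact ⟨_, isFreeWeight_natCast (hk.trans hkj), by simpa using lazyRatio_mono hk hkj⟩

/-- Builder's valuation of an untouched server when `α` is finite. -/
theorem add_one_mul_le_taskValue (i : ℕ) {j : ℕ} (hj : j ≤ i + 1) :
    (j + 1) * (1 - lazyRatio (i + 1)) ≤ taskValue i j := by
  refine le_trans ?_ (le_taskValue i j)
  have h1 := valueSlope_mul i
  have h2 := valueSlope_le_one_sub_lazyRatio i
  have h3 : (1 - lazyRatio (i + 1)) * (i + 2) = (i + 1) * share (i + 1) := by
    rw [lazyRatio_eq]
    push_cast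
    field_simp
    ring
  have h4 : (j : ℝ) ≤ i + 1 := by exact_mod_cast hj
  nlinarith

/-- Builder's valuation of an untouched server when nothing is known about `α`. -/
theorem add_one_mul_valueSlope_le (i j : ℕ) : (j + 1) * valueSlope i ≤ taskValue i j := by
  refine le_trans ?_ (le_taskValue i j)
  have := valueSlope_le_share_succ i
  linarith

/-! ### Competitive ratios -/

theorem competitiveRatio_eq {v : ℕ → ℕ} {r : ℝ}
    (hlow : ∀ ε > 0, ∀ᶠ n : ℕ in atTop, (r - ε) * n ≤ v n)
    (hup : ∀ ε > 0, ∃ C : ℝ, ∀ n : ℕ, (v n : ℝ) ≤ (r + ε) * n + C) : competitiveRatio v = r := by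
  refine Tendsto.liminf_eq (tendsto_order.2 ⟨fun a ha => ?_, fun a ha => ?_⟩)
  · filter_upwards [hlow ((r - a) / 2) (by linarith), eventually_gt_atTop 0] with n h1 hn
    have hn' : (0 : ℝ) < n := by exact_mod_cast hn
    rw [lt_div_iff₀ hn']
    nlinarith
  · obtain ⟨C, hC⟩ := hup ((a - r) / 2) (by linarith)
    have hlim := tendsto_const_div_atTop_nhds_zero_nat C
    filter_upwards [hlim.eventually_lt_const (show 0 < (a - r) / 2 by linarith),
      eventually_gt_atTop 0] with n h1 hn
    have hn' : (0 : ℝ) < n := by exact_mod_cast hn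
    rw [div_lt_iff₀ hn'] at h1 ⊢
    have := hC n
    linarith

/-- Bounds that hold for every balancing algorithm from below, and for every algorithm from above,
hold for the values of the game as well. -/
theorem competitiveRatio_eq_of_bounds {a : ℕ → ℕ∞} {r : ℝ}
    (hlow : ∀ ε > 0, ∀ᶠ n : ℕ in atTop, ∀ A : LazyAlgorithm (a n), A.IsBal →
      (r - ε) * n ≤ A.worstCase n)
    (hup : ∀ ε > 0, ∃ C : ℝ, ∀ n : ℕ, ∀ A : LazyAlgorithm (a n),
      (A.worstCase n : ℝ) ≤ (r + ε) * n + C) :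
    competitiveRatio (fun n => lazyValue (a n) n) = r ∧
    competitiveRatio (fun n => balValue (a n) n) = r ∧
    ∀ A : (n : ℕ) → LazyAlgorithm (a n), (∀ n, (A n).IsBal) →
      competitiveRatio (fun n => (A n).worstCase n) = r := by
  refine ⟨competitiveRatio_eq (fun ε hε => ?_) (fun ε hε => ?_),
    competitiveRatio_eq (fun ε hε => ?_) (fun ε hε => ?_),
    fun A hA => competitiveRatio_eq (fun ε hε => ?_) (fun ε hε => ?_)⟩
  · filter_upwards [hlow ε hε] with n hn
    refine (hn _ (isBal_balAlgorithm (a n))).trans ?_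
    exact_mod_cast worstCase_le_lazyValue _ n
  · obtain ⟨C, hC⟩ := hup ε hε
    refine ⟨C, fun n => ?_⟩
    obtain ⟨A, hA⟩ := exists_worstCase_eq_lazyValue (a n) n
    exact hA ▸ hC n A
  · filter_upwards [hlow ε hε] with n hn
    obtain ⟨A, hA, hAn⟩ := exists_worstCase_eq_balValue (a n) n
    exact hAn ▸ hn A hA
  · obtain ⟨C, hC⟩ := hup ε hε
    refine ⟨C, fun n => ?_⟩
    obtain ⟨A, -, hAn⟩ := exists_worstCase_eq_balValue (a n) n
    exact hAn ▸ hC n A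
  · filter_upwards [hlow ε hε] with n hn using hn _ (hA n)
  · obtain ⟨C, hC⟩ := hup ε hε
    exact ⟨C, fun n => hC n (A n)⟩

theorem competitiveRatio_const {α : ℕ} (hα : 1 ≤ α) :
    competitiveRatio (lazyValue (α : ℕ∞)) = lazyRatio α ∧
    competitiveRatio (balValue (α : ℕ∞)) = lazyRatio α ∧
    ∀ A : LazyAlgorithm (α : ℕ∞), A.IsBal → competitiveRatio A.worstCase = lazyRatio α := by
  refine (competitiveRatio_eq_of_bounds (a := fun _ => (α : ℕ∞)) (r := lazyRatio α)
    (fun ε hε => ?_) (fun ε hε => ?_)).imp_right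
      (And.imp_right fun h A hA => h (fun _ => A) fun _ => hA)
  · refine Eventually.of_forall fun n A hA => ?_
    have h := hA.le_worstCase (by exact_mod_cast hα) (isFreeWeight_natCast hα) n
    have : 0 ≤ ε * n := by positivity
    linarith
  · obtain ⟨i, rfl⟩ := Nat.exists_eq_add_of_le' hα
    refine ⟨1 + i * (2 * i + 1 : ℕ), fun n A => (A.worstCase_le (valueSlope_le_one_sub_lazyRatio i)
      (fun j hj => add_one_mul_le_taskValue i (by exact_mod_cast hj)) n).trans ?_⟩
    have : 0 ≤ ε * n := by positivity
    linarith

theorem competitiveRatio_of_tendsto_top {a : ℕ → ℕ∞} (ha : Tendsto a atTop (𝓝 ⊤)) :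
    competitiveRatio (fun n => lazyValue (a n) n) = lazyRatioLimit ∧
    competitiveRatio (fun n => balValue (a n) n) = lazyRatioLimit ∧
    ∀ A : (n : ℕ) → LazyAlgorithm (a n), (∀ n, (A n).IsBal) →
      competitiveRatio (fun n => (A n).worstCase n) = lazyRatioLimit := by
  refine competitiveRatio_eq_of_bounds (fun ε hε => ?_) (fun ε hε => ?_)
  · obtain ⟨k, hk, hk1⟩ := ((tendsto_lazyRatio.eventually_const_lt
      (show lazyRatioLimit - ε < lazyRatioLimit by linarith)).and
      (eventually_ge_atTop 1)).exists
    filter_upwards [ha.eventually_const_lt (ENat.natCast_lt_top k)] with n hn A hA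
    obtain ⟨ρ, hρ, hkρ⟩ := exists_isFreeWeight hk1 hn.le
    have hα : (1 : ℕ∞) ≤ a n := le_trans (by exact_mod_cast hk1) hn.le
    refine le_trans ?_ (hA.le_worstCase hα hρ n)
    exact mul_le_mul_of_nonneg_right (hk.le.trans hkρ) n.cast_nonneg
  · obtain ⟨i, hi⟩ := (tendsto_one_sub_slope.eventually_lt_const
      (show lazyRatioLimit < lazyRatioLimit + ε by linarith)).exists
    refine ⟨1 + i * (2 * i + 1 : ℕ), fun n A => (A.worstCase_le (i := i) le_rfl
      (fun j _ => add_one_mul_valueSlope_le i j) n).trans ?_⟩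
    have := mul_le_mul_of_nonneg_right hi.le (Nat.cast_nonneg (α := ℝ) n)
    linarith

theorem theorem2 :
    (∀ α : ℕ, 1 ≤ α →
      competitiveRatio (lazyValue (α : ℕ∞)) = lazyRatio α ∧
      competitiveRatio (balValue (α : ℕ∞)) = lazyRatio α ∧
      (∃ A : LazyAlgorithm (α : ℕ∞), A.IsBal) ∧
      ∀ A : LazyAlgorithm (α : ℕ∞), A.IsBal → competitiveRatio A.worstCase = lazyRatio α) ∧
    Tendsto lazyRatio atTop (𝓝 lazyRatioLimit) ∧
    (∀ a : ℕ → ℕ∞, Tendsto a atTop (𝓝 ⊤) →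
      competitiveRatio (fun n => lazyValue (a n) n) = lazyRatioLimit ∧
      competitiveRatio (fun n => balValue (a n) n) = lazyRatioLimit ∧
      ∀ A : (n : ℕ) → LazyAlgorithm (a n), (∀ n, (A n).IsBal) →
        competitiveRatio (fun n => (A n).worstCase n) = lazyRatioLimit) ∧
    |lazyRatioLimit - 0.588| < 0.0005 := by
  refine ⟨fun α hα => ?_, tendsto_lazyRatio, fun a ha => competitiveRatio_of_tendsto_top ha,
    abs_lazyRatioLimit_sub_lt⟩
  obtain ⟨h1, h2, h3⟩ := competitiveRatio_const hα
  exact ⟨h1, h2, ⟨_, isBal_balAlgorithm (α : ℕ∞)⟩, h3⟩
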